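/- A finite set $P\subset\mathbb R^2$ is in general position if no three of its points lie on a line. For integers $c\ge 2$, $s\ge 0$ and a finite set $P\subset\mathbb R^2$, let $X^{(c)}_{\le s}(P)$ be the minimum, over all colorings of the points of $P$ with $c$ colors, of the number of triangles with vertices in $P$ whose three vertices have the same color and which contain at most $s$ points of $P$ (of any color) in their interior. Let $X^{(c)}_{\le s}(n)$ be the minimum of $X^{(c)}_{\le s}(P)$ over all sets $P$ of $n$ points in general position in the plane. Theorem. For every fixed integer $c\ge 2$ there is a constant $L=L(c)>0$ such that $$X^{(c)}_{\le c-2}(n)\ \ge\ L\,n^{4/3}$$ for all sufficiently large $n$. In other words, every coloring with $c$ colors of a set of $n$ points in general position in the plane determines at least $L\,n^{4/3}$ monochromatic triangles with at most $c-2$ interior points, for all $n\ge N(c)$. -/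

import Mathlib

namespace AlmostEmpty

/-- The Euclidean plane. -/
abbrev Plane : Type := EuclideanSpace ℝ (Fin 2)

/-- A finite planar set is in general position if no three of its points lie on a line. -/
def GeneralPosition (P : Finset Plane) : Prop :=
  ∀ T : Finset Plane, T ⊆ P → T.card = 3 → ¬ Collinear ℝ (T : Set Plane)

open Classical in
/-- The points of `P` that lie in the interior of the triangle with vertex set `T`. -/
noncomputable def interiorPoints (P T : Finset Plane) : Finset Plane :=
  P.filter (fun p => p ∈ interior (convexHull ℝ (T : Set Plane)))

/-- All vertices of `T` have the same color. -/
def Monochromatic {c : ℕ} (φ : Plane → Fin c) (T : Finset Plane) : Prop :=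
  ∃ a : Fin c, ∀ p ∈ T, φ p = a

open Classical in
/-- The monochromatic triangles spanned by `P` (given by their vertex sets, so each triangle is
counted once) that have at most `s` points of `P`, of any color, in their interior. Only the
values of the coloring `φ` at the points of `P` matter. -/
noncomputable def monoTriangles {c : ℕ} (P : Finset Plane) (φ : Plane → Fin c) (s : ℕ) :
    Finset (Finset Plane) :=
  (P.powersetCard 3).filter (fun T => Monochromatic φ T ∧ (interiorPoints P T).card ≤ s)

/-- The minimum number, over all colorings of `P` with `c` colors, of monochromatic triangles
of `P` with at most `s` interior points. -/
noncomputable def minMonoTriangles (c s : ℕ) (P : Finset Plane) : ℕ :=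
  sInf {m : ℕ | ∃ φ : Plane → Fin c, m = (monoTriangles P φ s).card}

/-- The minimum of the previous quantity over all sets of `n` points in general position in the
plane. -/
noncomputable def minMonoTrianglesOfCard (c s n : ℕ) : ℕ :=
  sInf {m : ℕ | ∃ P : Finset Plane, GeneralPosition P ∧ P.card = n ∧ m = minMonoTriangles c s P}

/-- Sets in general position exist in every size, so the minimum above is over a non-empty
family. -/
theorem exists_generalPosition (n : ℕ) :
    ∃ P : Finset Plane, GeneralPosition P ∧ P.card = n := by
  classical
  let f : ℕ → Plane := fun k => !₂[(k : ℝ), (k : ℝ) ^ 2]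
  have hf : Function.Injective f := by
    intro a b h
    have h0 := congrArg (fun v : Plane => v 0) h
    simpa [f] using h0
  refine ⟨(Finset.range n).image f, ?_, by rw [Finset.card_image_of_injective _ hf]; simp⟩
  intro T hT hc hcol
  obtain ⟨x, y, z, hxy, hxz, hyz, rfl⟩ := Finset.card_eq_three.1 hc
  have hmem : ∀ w ∈ ({x, y, z} : Finset Plane), ∃ k : ℕ, f k = w := by
    intro w hw
    obtain ⟨k, -, hk⟩ := Finset.mem_image.1 (hT hw)
    exact ⟨k, hk⟩
  obtain ⟨i, rfl⟩ := hmem x (by simp)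
  obtain ⟨j, rfl⟩ := hmem y (by simp)
  obtain ⟨k, rfl⟩ := hmem z (by simp)
  obtain ⟨v, hv⟩ := (collinear_iff_of_mem (p₀ := f i) (by simp)).1 hcol
  obtain ⟨r, hr⟩ := hv (f j) (by simp)
  obtain ⟨t, ht⟩ := hv (f k) (by simp)
  have r0 := congrArg (fun v : Plane => v 0) hr
  have r1 := congrArg (fun v : Plane => v 1) hr
  have t0 := congrArg (fun v : Plane => v 0) ht
  have t1 := congrArg (fun v : Plane => v 1) ht
  simp [f] at r0 r1 t0 t1
  have hij : (j : ℝ) - i ≠ 0 := fun h => hxy (by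
    have : (i : ℝ) = j := by linarith
    rw [Nat.cast_injective this])
  have hik : (k : ℝ) - i ≠ 0 := fun h => hxz (by
    have : (i : ℝ) = k := by linarith
    rw [Nat.cast_injective this])
  have hjk : (k : ℝ) - j ≠ 0 := fun h => hyz (by
    have : (j : ℝ) = k := by linarith
    rw [Nat.cast_injective this])
  have e : ((j : ℝ) - i) * ((k : ℝ) - i) * ((k : ℝ) - j) = 0 := by
    have a0 : (j : ℝ) - i = r * v 0 := by linarith
    have a1 : (j : ℝ) ^ 2 - i ^ 2 = r * v 1 := by linarith
    have b0 : (k : ℝ) - i = t * v 0 := by linarith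
    have b1 : (k : ℝ) ^ 2 - i ^ 2 = t * v 1 := by linarith
    have : ((j : ℝ) - i) * ((k : ℝ) ^ 2 - i ^ 2) - ((k : ℝ) - i) * ((j : ℝ) ^ 2 - i ^ 2) = 0 := by
      rw [a0, a1, b0, b1]; ring
    linear_combination this
  exact mul_ne_zero (mul_ne_zero hij hik) hjk e

end AlmostEmpty

/-!
The *degree* of a point is the number of monochromatic triangles with at most `c - 2` interior
points that have it as a vertex. It is shown that at least `n / (8 c ^ 2)` of the `n` points have
degree at least `t = n ^ (1/3) / (4 c ^ 2)`; call these points heavy. Summing degrees counts each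
triangle three times, which gives `n ^ (4/3) / (96 c ^ 4)` triangles.

Triangles are produced by *packings*: interior-disjoint triangles with vertices in one color class
and no point of that class inside. A triangle of a packing that is not counted contains `c - 1`
points of other colors, and these are different for different triangles, so that a packing that is
large compared with the number of points of other colors yields many counted triangles
(`IsPacking.mul_card_le`). Two packings are used.

* Fans: in a convex region with `q` points, `r` of them of the color of the point `p`, there is a
  packing of `r - 2` triangles all having `p` as a vertex (`exists_packing_around`). If
  `c * r > q + D`, where `D = (c - 1) * (t + 2)`, then all `r` points are therefore heavy. In other
  words, a color that has a point of small degree in the region is not over-represented there; and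
  if no color is over-represented, then none is under-represented either
  (`sub_le_mul_of_forall_mul_le`).
* A triangle with `k` interior points of the color of its corners has a packing of `k + √k + 1`
  triangles, each of which has one of its corners as a vertex
  (`exists_packing_incident_to_corners`). If the number of points of other colors inside is at most
  `(c - 1) * (k + D)`, then some corner has degree of order `√k - D`.

Suppose now that there are few heavy points. Let `U` be the set of the other points of a most
frequent color. The convex hull of `U` has at most `c * D` vertices: another color has nearly the
fraction `1 / c` of the points in this hull, and since it is not over-represented in its own hull,
that smaller hull contains all but `c * D` of the points, yet it contains no vertex of the hull of
`U`. A fan from one vertex cuts the hull of `U` into at most `c * D` triangles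
(`exists_triangulating_fan`). Those in which other colors dominate have, in total, few points of
the color of `U`, because each of them contains at least as many heavy points. Hence some other
triangle contains of order `n / D`, and thus more than `(3 * t + D) ^ 2`, points of this color, and
so one of its corners is heavy, although it belongs to `U` (`card_le_mul_card_heavy`).
-/

namespace AlmostEmpty

/-! ### Orientation of triples and open triangles -/

/-- Twice the signed area of the triangle `a b c`; positive when it is traversed
counterclockwise. -/
def orient (a b c : Plane) : ℝ :=
  (b 0 - a 0) * (c 1 - a 1) - (b 1 - a 1) * (c 0 - a 0)

/-- The open triangle with vertices `a`, `b`, `c`. -/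
def tri (a b c : Plane) : Set Plane := interior (convexHull ℝ {a, b, c})

theorem orient_cycle (a b c : Plane) : orient b c a = orient a b c := by
  unfold orient; ring

theorem orient_swap (a b c : Plane) : orient a c b = -orient a b c := by
  unfold orient; ring

@[simp] theorem orient_self_left (a b : Plane) : orient a a b = 0 := by
  unfold orient; ring

@[simp] theorem orient_self_right (a b : Plane) : orient a b b = 0 := by
  unfold orient; ring

@[simp] theorem orient_self_outer (a b : Plane) : orient a b a = 0 := by
  unfold orient; ring

/-- The three-term Plücker relation for the directions seen from `p`. -/
theorem orient_plucker (p u x y z : Plane) :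
    orient p u y * orient p x z = orient p u x * orient p y z + orient p u z * orient p x y := by
  unfold orient; ring

theorem orient_combo (p q a b c : Plane) {α β γ : ℝ} (h : α + β + γ = 1) :
    orient p q (α • a + β • b + γ • c) =
      α * orient p q a + β * orient p q b + γ * orient p q c := by
  simp only [orient, PiLp.add_apply, PiLp.smul_apply, smul_eq_mul]
  linear_combination ((q 0 - p 0) * p 1 - (q 1 - p 1) * p 0) * (h)

theorem collinear_of_orient_eq_zero {a b c : Plane} (hab : a ≠ b) (h : orient a b c = 0) :
    Collinear ℝ ({a, b, c} : Set Plane) := by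
  rw [collinear_iff_of_mem (p₀ := a) (by simp)]
  refine ⟨b - a, ?_⟩
  have hne : b 0 - a 0 ≠ 0 ∨ b 1 - a 1 ≠ 0 := by
    by_contra! hcon
    apply hab
    ext i
    fin_cases i
    · simp; linarith [hcon.1]
    · simp; linarith [hcon.2]
  unfold orient at h
  rintro x (rfl | rfl | rfl)
  · exact ⟨0, by simp⟩
  · exact ⟨1, by simp⟩
  · rcases hne with h0 | h0
    · refine ⟨(x 0 - a 0) / (b 0 - a 0), ?_⟩
      ext i
      fin_cases i
      · simp; field_simp; ring
      · simp; field_simp; linear_combination h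
    · refine ⟨(x 1 - a 1) / (b 1 - a 1), ?_⟩
      ext i
      fin_cases i
      · simp; field_simp; linear_combination -h
      · simp; field_simp; ring

theorem GeneralPosition.orient_ne_zero {P : Finset Plane} (hP : GeneralPosition P)
    {x y z : Plane} (hx : x ∈ P) (hy : y ∈ P) (hz : z ∈ P) (hxy : x ≠ y) (hxz : x ≠ z)
    (hyz : y ≠ z) : orient x y z ≠ 0 := by
  classical
  intro h
  refine hP {x, y, z} ?_ (Finset.card_eq_three.2 ⟨x, y, z, hxy, hxz, hyz, rfl⟩) ?_
  · intro w hw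
    simp only [Finset.mem_insert, Finset.mem_singleton] at hw
    rcases hw with rfl | rfl | rfl <;> assumption
  · simpa using collinear_of_orient_eq_zero hxy h

theorem not_collinear_of_orient_ne_zero {a b c : Plane} (h : orient a b c ≠ 0) :
    ¬ Collinear ℝ ({a, b, c} : Set Plane) := by
  intro hcol
  obtain ⟨v, hv⟩ := (collinear_iff_of_mem (p₀ := a) (by simp)).1 hcol
  obtain ⟨r, rfl⟩ := hv b (by simp)
  obtain ⟨t, rfl⟩ := hv c (by simp)
  apply h
  simp [orient]
  ring

/-- Points of an open triangle are the convex combinations of the vertices with positive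
weights. -/
theorem mem_tri_iff_combo {a b c : Plane} (h : orient a b c ≠ 0) {x : Plane} :
    x ∈ tri a b c ↔ ∃ α β γ : ℝ, 0 < α ∧ 0 < β ∧ 0 < γ ∧ α + β + γ = 1 ∧
      x = α • a + β • b + γ • c := by
  have hai : AffineIndependent ℝ ![a, b, c] :=
    affineIndependent_iff_not_collinear_set.2 (not_collinear_of_orient_ne_zero h)
  have htop : affineSpan ℝ (Set.range ![a, b, c]) = ⊤ := by
    rw [hai.affineSpan_eq_top_iff_card_eq_finrank_add_one]
    simp
  let B : AffineBasis (Fin 3) ℝ Plane := ⟨![a, b, c], hai, htop⟩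
  have hB : ⇑B = ![a, b, c] := rfl
  have hr : ({a, b, c} : Set Plane) = Set.range B := by
    rw [hB]; ext; simp [eq_comm]; tauto
  rw [tri, hr, AffineBasis.interior_convexHull]
  constructor
  · intro hx
    refine ⟨B.coord 0 x, B.coord 1 x, B.coord 2 x, hx 0, hx 1, hx 2, ?_, ?_⟩
    · have := B.sum_coord_apply_eq_one x
      rwa [Fin.sum_univ_three] at this
    · have := B.linear_combination_coord_eq_self x
      rw [Fin.sum_univ_three] at this
      exact this.symm
  · rintro ⟨α, β, γ, hα, hβ, hγ, h1, hx⟩ i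
    have hs := B.sum_coord_apply_eq_one x
    have he := B.linear_combination_coord_eq_self x
    rw [Fin.sum_univ_three] at hs he
    have he' : B.coord 0 x • a + B.coord 1 x • b + B.coord 2 x • c = x := he
    have e1 := orient_combo b c a b c hs
    have e2 := orient_combo c a a b c hs
    have e3 := orient_combo a b a b c hs
    rw [he', hx, orient_combo _ _ _ _ _ h1] at e1 e2 e3
    have c1 := orient_cycle a b c
    have c2 := orient_cycle c a b
    simp only [orient_self_right, orient_self_outer, mul_zero, add_zero, zero_add, ← hx,
      c1, ← c2] at e1 e2 e3
    have e2' := mul_right_cancel₀ h e2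
    have e1' := mul_right_cancel₀ h e1
    have e3' := mul_right_cancel₀ h e3
    fin_cases i
    · exact e1' ▸ hα
    · exact e2' ▸ hβ
    · exact e3' ▸ hγ

theorem mem_tri_iff {a b c : Plane} (h : 0 < orient a b c) {x : Plane} :
    x ∈ tri a b c ↔ 0 < orient a b x ∧ 0 < orient b c x ∧ 0 < orient c a x := by
  have c1 := orient_cycle a b c
  have c2 := orient_cycle c a b
  rw [mem_tri_iff_combo h.ne']
  constructor
  · rintro ⟨α, β, γ, hα, hβ, hγ, h1, rfl⟩
    simp only [orient_combo _ _ _ _ _ h1, orient_self_right, orient_self_outer, mul_zero,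
      add_zero, zero_add, c1, ← c2]
    exact ⟨mul_pos hγ h, mul_pos hα h, mul_pos hβ h⟩
  · rintro ⟨h1, h2, h3⟩
    refine ⟨orient b c x / orient a b c, orient c a x / orient a b c,
      orient a b x / orient a b c, div_pos h2 h, div_pos h3 h, div_pos h1 h, ?_, ?_⟩
    · rw [← add_div, ← add_div, div_eq_one_iff_eq h.ne']
      unfold orient; ring
    · have hne := h.ne'
      ext i
      fin_cases i
      · simp only [Fin.zero_eta, PiLp.add_apply, PiLp.smul_apply, smul_eq_mul]
        field_simp
        unfold orient; ring
      · simp only [Fin.mk_one, PiLp.add_apply, PiLp.smul_apply, smul_eq_mul]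
        field_simp
        unfold orient; ring

theorem tri_rotate (a b c : Plane) : tri b c a = tri a b c := by
  unfold tri
  congr 2
  ext; simp; tauto

theorem tri_nonempty {a b c : Plane} (h : orient a b c ≠ 0) : (tri a b c).Nonempty :=
  ⟨_, (mem_tri_iff_combo h).2 ⟨1 / 3, 1 / 3, 1 / 3, by norm_num, by norm_num, by norm_num,
    by norm_num, rfl⟩⟩

theorem convex_tri (a b c : Plane) : Convex ℝ (tri a b c) := (convex_convexHull ℝ _).interior

theorem tri_subset_of_convex {K : Set Plane} (hK : Convex ℝ K) {a b c : Plane} (ha : a ∈ K)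
    (hb : b ∈ K) (hc : c ∈ K) : tri a b c ⊆ K :=
  interior_subset.trans (convexHull_min
    (by rintro x (rfl | rfl | rfl) <;> assumption) hK)

theorem tri_subset_tri {a b c x y z : Plane} (hx : x ∈ convexHull ℝ {a, b, c})
    (hy : y ∈ convexHull ℝ {a, b, c}) (hz : z ∈ convexHull ℝ {a, b, c}) :
    tri x y z ⊆ tri a b c :=
  interior_mono (convexHull_min (by rintro x (rfl | rfl | rfl) <;> assumption)
    (convex_convexHull ℝ _))

theorem vertices_mem_hull (a b c : Plane) : a ∈ convexHull ℝ {a, b, c} ∧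
    b ∈ convexHull ℝ {a, b, c} ∧ c ∈ convexHull ℝ {a, b, c} :=
  ⟨subset_convexHull _ _ (by simp), subset_convexHull _ _ (by simp),
    subset_convexHull _ _ (by simp)⟩

theorem tri_subset_hull (a b c : Plane) : tri a b c ⊆ convexHull ℝ {a, b, c} := interior_subset

/-- Points of a triangle with two vertices weakly to the left of the directed line `p q`
through the third, not both on it, lie strictly to the left. -/
theorem orient_pos_of_mem_tri {p q x y z : Plane} (h : orient p x y ≠ 0)
    (hx : 0 ≤ orient p q x) (hy : 0 ≤ orient p q y) (hxy : 0 < orient p q x + orient p q y)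
    (hz : z ∈ tri p x y) : 0 < orient p q z := by
  obtain ⟨α, β, γ, hα, hβ, hγ, h1, rfl⟩ := (mem_tri_iff_combo h).1 hz
  rw [orient_combo _ _ _ _ _ h1]
  simp only [orient_self_outer, mul_zero, zero_add]
  rcases hx.eq_or_lt with h0 | h0
  · rw [← h0] at hxy ⊢
    simp at hxy ⊢
    positivity
  · have := mul_nonneg hγ.le hy
    positivity

theorem convex_orient_nonneg (p q : Plane) : Convex ℝ {x | 0 ≤ orient p q x} := by
  intro x hx y hy α β hα hβ h1
  have := orient_combo p q x y y (α := α) (β := β) (γ := 0) (by linarith)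
  simp only [zero_smul, add_zero, zero_mul] at this
  change 0 ≤ orient p q x at hx
  change 0 ≤ orient p q y at hy
  change 0 ≤ orient p q _
  rw [this]
  positivity

/-- An interior point `z` splits an open triangle into three pairwise disjoint open triangles. -/
theorem disjoint_subtriangles {b c y z : Plane} (h : 0 < orient b c y) (hz : z ∈ tri b c y) :
    Disjoint (tri b c z) (tri b z y) ∧ Disjoint (tri b c z) (tri c y z) ∧
      Disjoint (tri b z y) (tri c y z) := by
  obtain ⟨h1, h2, h3⟩ := (mem_tri_iff h).1 hz
  have h2' : 0 < orient b z y := by rw [← orient_cycle, ← orient_cycle]; exact h3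
  refine ⟨Set.disjoint_left.2 ?_, Set.disjoint_left.2 ?_, Set.disjoint_left.2 ?_⟩ <;>
  · intro x hx hx'
    simp only [mem_tri_iff, h1, h2, h2'] at hx hx'
    have e1 := orient_swap x b z
    have e2 := orient_swap x c z
    have e3 := orient_swap x y z
    have f1 := orient_cycle x b z
    have f2 := orient_cycle x c z
    have f3 := orient_cycle x y z
    have g1 := orient_cycle x z b
    have g2 := orient_cycle x z c
    have g3 := orient_cycle x z y
    linarith [hx.1, hx.2.1, hx.2.2, hx'.1, hx'.2.1, hx'.2.2]

theorem mem_subtriangles {b c y z x : Plane} (h : 0 < orient b c y) (hz : z ∈ tri b c y)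
    (hx : x ∈ tri b c y) (hb : orient z b x ≠ 0) (hc : orient z c x ≠ 0)
    (hy : orient z y x ≠ 0) : x ∈ tri b c z ∨ x ∈ tri b z y ∨ x ∈ tri c y z := by
  obtain ⟨h1, h2, h3⟩ := (mem_tri_iff h).1 hz
  have h2' : 0 < orient b z y := by rw [← orient_cycle, ← orient_cycle]; exact h3
  obtain ⟨k1, k2, k3⟩ := (mem_tri_iff h).1 hx
  obtain ⟨α, β, γ, hα, hβ, hγ, hs, hzz⟩ := (mem_tri_iff_combo h.ne').1 hz
  have key : α * orient z b x + β * orient z c x + γ * orient z y x = 0 := by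
    have := orient_combo x z b c y hs
    rw [← hzz, orient_self_right] at this
    rw [← orient_cycle z b x, ← orient_cycle z c x, ← orient_cycle z y x,
      ← orient_cycle b x z, ← orient_cycle c x z, ← orient_cycle y x z]
    linarith
  have e1 : orient b z x = -orient z b x := by unfold orient; ring
  have e2 : orient c z x = -orient z c x := by unfold orient; ring
  have e3 : orient y z x = -orient z y x := by unfold orient; ring
  simp only [mem_tri_iff h1, mem_tri_iff h2, mem_tri_iff h2', e1, e2, e3]
  rcases hb.lt_or_gt with hb | hb <;> rcases hc.lt_or_gt with hc | hc <;>
    rcases hy.lt_or_gt with hy | hy <;> first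
    | (exact Or.inl ⟨by linarith, by linarith, by linarith⟩)
    | (exact Or.inr (Or.inl ⟨by linarith, by linarith, by linarith⟩))
    | (exact Or.inr (Or.inr ⟨by linarith, by linarith, by linarith⟩))
    | (exfalso; nlinarith [mul_pos hα hb, mul_pos hβ hc, mul_pos hγ hy])
    | (exfalso; nlinarith [mul_neg_of_pos_of_neg hα hb, mul_neg_of_pos_of_neg hβ hc,
        mul_neg_of_pos_of_neg hγ hy])

/-! ### Points in angular order around a point -/

theorem exists_maximal_of_trans {α : Type*} (r : α → α → Prop) {s : Finset α}
    (hs : s.Nonempty) (irr : ∀ x ∈ s, ¬ r x x)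
    (tr : ∀ x ∈ s, ∀ y ∈ s, ∀ z ∈ s, r x y → r y z → r x z) :
    ∃ m ∈ s, ∀ x ∈ s, ¬ r m x := by
  classical
  induction hs using Finset.Nonempty.cons_induction with
  | singleton a => exact ⟨a, by simp, by simpa using irr⟩
  | cons a s ha hs ih =>
    obtain ⟨m, hm, hmax⟩ := ih (fun x hx => irr x (Finset.mem_cons_of_mem hx))
      (fun x hx y hy z hz => tr x (Finset.mem_cons_of_mem hx) y (Finset.mem_cons_of_mem hy) z
        (Finset.mem_cons_of_mem hz))
    have hm' : m ∈ Finset.cons a s ha := Finset.mem_cons_of_mem hm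
    have ha' : a ∈ Finset.cons a s ha := Finset.mem_cons_self a s
    by_cases hma : r m a
    · refine ⟨a, ha', fun x hx hax => ?_⟩
      rcases Finset.mem_cons.1 hx with rfl | hxs
      · exact irr _ hx hax
      · exact hmax x hxs (tr m hm' a ha' x hx hma hax)
    · refine ⟨m, hm', fun x hx => ?_⟩
      rcases Finset.mem_cons.1 hx with rfl | hxs
      · exact hma
      · exact hmax x hxs

/-- The directions from `p` to the points of `A` are pairwise non-parallel, and the relation
`0 < orient p x y` orders them linearly (as it does when they lie in a half-plane). -/
structure StarOrdered (p : Plane) (A : Finset Plane) : Prop where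
  ne : ∀ x ∈ A, ∀ y ∈ A, x ≠ y → orient p x y ≠ 0
  trans : ∀ x ∈ A, ∀ y ∈ A, ∀ z ∈ A, 0 < orient p x y → 0 < orient p y z → 0 < orient p x z

theorem StarOrdered.pos_or_pos {p : Plane} {A : Finset Plane} (h : StarOrdered p A) {x y : Plane}
    (hx : x ∈ A) (hy : y ∈ A) (hxy : x ≠ y) : 0 < orient p x y ∨ 0 < orient p y x := by
  rcases (h.ne x hx y hy hxy).lt_or_gt with h0 | h0
  · right; rw [orient_swap]; linarith
  · exact Or.inl h0

theorem StarOrdered.exists_last {p : Plane} {A : Finset Plane} (h : StarOrdered p A)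
    (hA : A.Nonempty) : ∃ m ∈ A, ∀ x ∈ A, x ≠ m → 0 < orient p x m := by
  obtain ⟨m, hm, hmax⟩ := exists_maximal_of_trans (fun x y => 0 < orient p x y) hA
    (fun x _ => by simp) h.trans
  exact ⟨m, hm, fun x hx hxm => (h.pos_or_pos hx hm hxm).resolve_right (hmax x hx)⟩

theorem StarOrdered.exists_first {p : Plane} {A : Finset Plane} (h : StarOrdered p A)
    (hA : A.Nonempty) : ∃ m ∈ A, ∀ x ∈ A, x ≠ m → 0 < orient p m x := by
  obtain ⟨m, hm, hmax⟩ := exists_maximal_of_trans (fun x y => 0 < orient p y x) hA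
    (fun x _ => by simp) (fun x hx y hy z hz hxy hyz => h.trans z hz y hy x hx hyz hxy)
  exact ⟨m, hm, fun x hx hxm => (h.pos_or_pos hx hm hxm).resolve_left (hmax x hx)⟩

theorem StarOrdered.mono {p : Plane} {A B : Finset Plane} (h : StarOrdered p A) (hB : B ⊆ A) :
    StarOrdered p B :=
  ⟨fun x hx y hy => h.ne x (hB hx) y (hB hy),
    fun x hx y hy z hz => h.trans x (hB hx) y (hB hy) z (hB hz)⟩

/-- Transitivity of the angular order among directions to the left of the direction of `u`. -/
theorem orient_trans_of_left {p u x y z : Plane} (hx : 0 ≤ orient p u x) (hy : 0 < orient p u y)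
    (hz : 0 < orient p u z) (hxy : 0 < orient p x y) (hyz : 0 < orient p y z) :
    0 < orient p x z := by
  have := orient_plucker p u x y z
  have h1 := mul_nonneg hx hyz.le
  have h2 := mul_pos hz hxy
  exact pos_of_mul_pos_right (a := orient p u y) (by linarith) hy.le

theorem starOrdered_of_first {p u : Plane} {A : Finset Plane}
    (hne : ∀ x ∈ A, ∀ y ∈ A, x ≠ y → orient p x y ≠ 0)
    (hu : ∀ x ∈ A, x ≠ u → 0 < orient p u x) : StarOrdered p A := by
  refine ⟨hne, fun x hx y hy z hz hxy hyz => ?_⟩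
  have h0 : ∀ x ∈ A, 0 ≤ orient p u x := fun x hx => by
    by_cases h : x = u
    · simp [h]
    · exact (hu x hx h).le
  have key : ∀ x ∈ A, ∀ y ∈ A, 0 < orient p x y → 0 < orient p u y := fun x hx y hy hxy => by
    refine hu y hy ?_
    rintro rfl
    rw [orient_swap] at hxy
    linarith [h0 x hx]
  exact orient_trans_of_left (h0 x hx) (key x hx y hy hxy) (key y hy z hz hyz) hxy hyz

theorem starOrdered_of_last {p u : Plane} {A : Finset Plane}
    (hne : ∀ x ∈ A, ∀ y ∈ A, x ≠ y → orient p x y ≠ 0)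
    (hu : ∀ x ∈ A, x ≠ u → 0 < orient p x u) : StarOrdered p A := by
  refine ⟨hne, fun x hx y hy z hz hxy hyz => ?_⟩
  have h0 : ∀ x ∈ A, 0 ≤ orient p x u := fun x hx => by
    by_cases h : x = u
    · simp [h]
    · exact (hu x hx h).le
  have key : ∀ x ∈ A, ∀ y ∈ A, 0 < orient p x y → 0 < orient p x u := fun x hx y hy hxy => by
    refine hu x hx ?_
    rintro rfl
    rw [orient_swap] at hxy
    linarith [h0 y hy]
  have hpl := orient_plucker p u x y z
  rw [orient_swap p x u, orient_swap p y u, orient_swap p z u] at hpl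
  have h1 := mul_pos (key x hx y hy hxy) hyz
  have h2 := mul_nonneg (h0 z hz) hxy.le
  exact pos_of_mul_pos_right (a := orient p y u) (by linarith) (h0 y hy)

open Classical in
/-- The pairs of points of `A` that are consecutive in the angular order around `p`. -/
noncomputable def consecutive (p : Plane) (A : Finset Plane) : Finset (Plane × Plane) :=
  (A ×ˢ A).filter fun e =>
    0 < orient p e.1 e.2 ∧ ∀ w ∈ A, ¬ (0 < orient p e.1 w ∧ 0 < orient p w e.2)

theorem mem_consecutive {p : Plane} {A : Finset Plane} {e : Plane × Plane} :
    e ∈ consecutive p A ↔ (e.1 ∈ A ∧ e.2 ∈ A) ∧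
      0 < orient p e.1 e.2 ∧ ∀ w ∈ A, ¬ (0 < orient p e.1 w ∧ 0 < orient p w e.2) := by
  simp [consecutive]

theorem StarOrdered.exists_succ {p : Plane} {A : Finset Plane} (h : StarOrdered p A) {x w : Plane}
    (hx : x ∈ A) (hw : w ∈ A) (hxw : 0 < orient p x w) : ∃ y, (x, y) ∈ consecutive p A := by
  classical
  obtain ⟨y, hy, hmin⟩ := (h.mono (Finset.filter_subset (fun w => 0 < orient p x w) A)).exists_first
    ⟨w, by simp [hw, hxw]⟩
  rw [Finset.mem_filter] at hy
  refine ⟨y, mem_consecutive.2 ⟨⟨hx, hy.1⟩, hy.2, fun v hv hcon => ?_⟩⟩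
  have := hmin v (Finset.mem_filter.2 ⟨hv, hcon.1⟩) (by rintro rfl; simp at hcon)
  rw [orient_swap] at this
  linarith [hcon.2]

theorem StarOrdered.consecutive_fst_injOn {p : Plane} {A : Finset Plane} (h : StarOrdered p A) :
    Set.InjOn Prod.fst (consecutive p A : Set (Plane × Plane)) := by
  rintro ⟨x, y⟩ he ⟨x', y'⟩ he' (rfl : x = x')
  obtain ⟨⟨hx, hy⟩, h1, h2⟩ := mem_consecutive.1 he
  obtain ⟨⟨hx', hy'⟩, h1', h2'⟩ := mem_consecutive.1 he'
  by_contra hne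
  have hyy : y ≠ y' := fun hyy => hne (by rw [hyy])
  rcases h.pos_or_pos hy hy' hyy with h0 | h0
  · exact h2' y hy ⟨h1, h0⟩
  · exact h2 y' hy' ⟨h1', h0⟩

theorem StarOrdered.card_consecutive_le {p : Plane} {A : Finset Plane} (h : StarOrdered p A) :
    (consecutive p A).card ≤ A.card :=
  Finset.card_le_card_of_injOn Prod.fst (fun _ he => (mem_consecutive.1 he).1.1)
    h.consecutive_fst_injOn

theorem StarOrdered.card_le_consecutive {p : Plane} {A : Finset Plane} (h : StarOrdered p A) :
    A.card ≤ (consecutive p A).card + 1 := by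
  classical
  rcases A.eq_empty_or_nonempty with rfl | hA
  · simp
  obtain ⟨m, hm, hmax⟩ := h.exists_last hA
  have hsub : A.erase m ⊆ (consecutive p A).image Prod.fst := by
    intro x hx
    obtain ⟨hxm, hx⟩ := Finset.mem_erase.1 hx
    obtain ⟨y, hy⟩ := h.exists_succ hx hm (hmax x hx hxm)
    exact Finset.mem_image.2 ⟨_, hy, rfl⟩
  have := (Finset.card_le_card hsub).trans Finset.card_image_le
  rw [Finset.card_erase_of_mem hm] at this
  omega

theorem disjoint_tri_of_order {p x y x' y' : Plane} (h : 0 < orient p x y)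
    (h' : 0 < orient p x' y') (hxx : 0 < orient p x x') (hyx : 0 ≤ orient p y x') :
    Disjoint (tri p x y) (tri p x' y') := by
  refine Set.disjoint_left.2 fun z hz hz' => ?_
  obtain ⟨h1, -, h3⟩ := (mem_tri_iff h).1 hz
  obtain ⟨k1, -, k3⟩ := (mem_tri_iff h').1 hz'
  rw [← orient_cycle] at h3
  have hpl := orient_plucker p x z y x'
  have h4 := mul_pos hxx h3
  have h5 := mul_nonneg h1.le hyx
  have := pos_of_mul_pos_right (a := orient p x y) (b := orient p z x') (by linarith) h.le
  rw [orient_swap] at this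
  linarith

theorem StarOrdered.disjoint_tri {p : Plane} {A : Finset Plane} (h : StarOrdered p A)
    {e e' : Plane × Plane} (he : e ∈ consecutive p A) (he' : e' ∈ consecutive p A)
    (hne : e ≠ e') : Disjoint (tri p e.1 e.2) (tri p e'.1 e'.2) := by
  have key : ∀ e ∈ consecutive p A, ∀ e' ∈ consecutive p A, 0 < orient p e.1 e'.1 →
      Disjoint (tri p e.1 e.2) (tri p e'.1 e'.2) := by
    intro e he e' he' h0
    obtain ⟨⟨hx, hy⟩, h1, h2⟩ := mem_consecutive.1 he
    obtain ⟨⟨hx', hy'⟩, h1', h2'⟩ := mem_consecutive.1 he'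
    refine disjoint_tri_of_order h1 h1' h0 ?_
    by_contra! hcon
    exact h2 _ hx' ⟨h0, by rw [orient_swap]; linarith⟩
  have hf : e.1 ≠ e'.1 := fun hf => hne (h.consecutive_fst_injOn he he' hf)
  rcases h.pos_or_pos (mem_consecutive.1 he).1.1 (mem_consecutive.1 he').1.1 hf with h0 | h0
  · exact key e he e' he' h0
  · exact (key e' he' e he h0).symm

/-! ### Packings of empty triangles -/

/-- The interior of the triangle with vertex set `T`. -/
abbrev openTriangle (T : Finset Plane) : Set Plane := interior (convexHull ℝ (T : Set Plane))

/-- A family of triangles with vertices in `X`, none of them containing a point of `X` in its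
interior, whose interiors are non-empty, pairwise disjoint and contained in the region `K`. -/
structure IsPacking (X : Finset Plane) (K : Set Plane) (F : Finset (Finset Plane)) : Prop where
  subset : ∀ T ∈ F, T ⊆ X
  card_eq : ∀ T ∈ F, T.card = 3
  region : ∀ T ∈ F, openTriangle T ⊆ K
  empty : ∀ T ∈ F, ∀ x ∈ X, x ∉ openTriangle T
  nonempty : ∀ T ∈ F, (openTriangle T).Nonempty
  disjoint : ∀ T ∈ F, ∀ T' ∈ F, T ≠ T' → Disjoint (openTriangle T) (openTriangle T')

theorem isPacking_empty (X : Finset Plane) (K : Set Plane) : IsPacking X K ∅ := by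
  constructor <;> simp

open Classical in
theorem IsPacking.union {X : Finset Plane} {K K₁ K₂ : Set Plane} {F₁ F₂ : Finset (Finset Plane)}
    (h₁ : IsPacking X K₁ F₁) (h₂ : IsPacking X K₂ F₂) (hK : Disjoint K₁ K₂) (hK₁ : K₁ ⊆ K)
    (hK₂ : K₂ ⊆ K) : IsPacking X K (F₁ ∪ F₂) ∧ (F₁ ∪ F₂).card = F₁.card + F₂.card := by
  have hd : ∀ T ∈ F₁, ∀ T' ∈ F₂, Disjoint (openTriangle T) (openTriangle T') := fun T hT T' hT' =>
    hK.mono (h₁.region T hT) (h₂.region T' hT')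
  refine ⟨⟨?_, ?_, ?_, ?_, ?_, ?_⟩, ?_⟩
  · intro T hT
    exact (Finset.mem_union.1 hT).elim (h₁.subset T) (h₂.subset T)
  · intro T hT
    exact (Finset.mem_union.1 hT).elim (h₁.card_eq T) (h₂.card_eq T)
  · intro T hT
    exact (Finset.mem_union.1 hT).elim (fun h => (h₁.region T h).trans hK₁)
      (fun h => (h₂.region T h).trans hK₂)
  · intro T hT
    exact (Finset.mem_union.1 hT).elim (h₁.empty T) (h₂.empty T)
  · intro T hT
    exact (Finset.mem_union.1 hT).elim (h₁.nonempty T) (h₂.nonempty T)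
  · intro T hT T' hT' hne
    rcases Finset.mem_union.1 hT with h | h <;> rcases Finset.mem_union.1 hT' with h' | h'
    · exact h₁.disjoint T h T' h' hne
    · exact hd T h T' h'
    · exact (hd T' h' T h).symm
    · exact h₂.disjoint T h T' h' hne
  · refine Finset.card_union_of_disjoint (Finset.disjoint_left.2 fun T hT hT' => ?_)
    obtain ⟨x, hx⟩ := h₁.nonempty T hT
    exact Set.disjoint_left.1 (hd T hT T hT') hx hx

theorem card_three_of_orient_ne_zero [DecidableEq Plane] {a b c : Plane} (h : orient a b c ≠ 0) :
    ({a, b, c} : Finset Plane).card = 3 := by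
  refine Finset.card_eq_three.2 ⟨a, b, c, ?_, ?_, ?_, rfl⟩ <;> rintro rfl <;> simp at h

open Classical in
/-- Joining `p` to the pairs of consecutive points of `A` gives a packing. -/
theorem exists_fan {X A : Finset Plane} {K : Set Plane} {p : Plane} (h : StarOrdered p A)
    (hp : p ∈ X) (hA : A ⊆ X)
    (hK : ∀ x ∈ A, ∀ y ∈ A, 0 < orient p x y → tri p x y ⊆ K)
    (hX : ∀ z ∈ X, ∀ x ∈ A, ∀ y ∈ A, 0 < orient p x y → z ∈ tri p x y → z ∈ A) :
    ∃ F, IsPacking X K F ∧ (∀ T ∈ F, p ∈ T) ∧ A.card ≤ F.card + 1 := by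
  let f : Plane × Plane → Finset Plane := fun e => {p, e.1, e.2}
  have hf : ∀ e, openTriangle (f e) = tri p e.1 e.2 := fun e => by
    simp [openTriangle, f, tri]
  have hinj : Set.InjOn f (consecutive p A : Set (Plane × Plane)) := by
    intro e he e' he' hee
    by_contra hne
    have hd := h.disjoint_tri he he' hne
    rw [← hf, ← hf, hee, hf] at hd
    obtain ⟨x, hx⟩ := tri_nonempty (mem_consecutive.1 he').2.1.ne'
    exact Set.disjoint_left.1 hd hx hx
  refine ⟨(consecutive p A).image f, ⟨?_, ?_, ?_, ?_, ?_, ?_⟩, ?_, ?_⟩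
  · simp only [Finset.forall_mem_image]
    intro e he
    obtain ⟨⟨hx, hy⟩, h1, h2⟩ := mem_consecutive.1 he
    intro z hz
    simp only [f, Finset.mem_insert, Finset.mem_singleton] at hz
    rcases hz with rfl | rfl | rfl
    exacts [hp, hA hx, hA hy]
  · simp only [Finset.forall_mem_image]
    intro e he
    exact card_three_of_orient_ne_zero (mem_consecutive.1 he).2.1.ne'
  · simp only [Finset.forall_mem_image, hf]
    intro e he
    obtain ⟨⟨hx, hy⟩, h1, h2⟩ := mem_consecutive.1 he
    exact hK _ hx _ hy h1
  · simp only [Finset.forall_mem_image, hf]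
    intro e he z hz hzt
    obtain ⟨⟨hx, hy⟩, h1, h2⟩ := mem_consecutive.1 he
    obtain ⟨k1, -, k3⟩ := (mem_tri_iff h1).1 hzt
    refine h2 z (hX z hz _ hx _ hy h1 hzt) ⟨k1, ?_⟩
    rwa [← orient_cycle] at k3
  · simp only [Finset.forall_mem_image, hf]
    intro e he
    exact tri_nonempty (mem_consecutive.1 he).2.1.ne'
  · simp only [Finset.forall_mem_image, hf]
    intro e he e' he' hne
    exact h.disjoint_tri he he' fun hee => hne (by rw [hee])
  · simp only [Finset.forall_mem_image]
    intro e he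
    simp [f]
  · rw [Finset.card_image_of_injOn hinj]
    exact h.card_le_consecutive

open Classical in
/-- Every point `p` of a set in general position is a vertex of a packing that uses all the points
of a convex region: a line through `p` and one further point splits them into two fans. -/
theorem exists_packing_around {P X : Finset Plane} (hP : GeneralPosition P) (hXP : X ⊆ P)
    {K : Set Plane} (hK : Convex ℝ K) {p : Plane} (hp : p ∈ X) (hpK : p ∈ K) :
    ∃ F, IsPacking X K F ∧ (∀ T ∈ F, p ∈ T) ∧
      (X.filter (· ∈ K)).card ≤ F.card + 2 := by
  set A := (X.filter (· ∈ K)).erase p with hAdef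
  have hAcard : (X.filter (· ∈ K)).card = A.card + 1 := by
    rw [hAdef, Finset.card_erase_add_one (by simp [hp, hpK])]
  have hA : ∀ x, x ∈ A ↔ x ≠ p ∧ x ∈ X ∧ x ∈ K := fun x => by simp [hAdef]
  rcases A.eq_empty_or_nonempty with hA0 | ⟨u, hu⟩
  · exact ⟨∅, isPacking_empty _ _, by simp, by rw [hAcard, hA0]; simp⟩
  have hne : ∀ x ∈ A, ∀ y ∈ A, x ≠ y → orient p x y ≠ 0 := fun x hx y hy hxy => by
    rw [hA] at hx hy
    exact hP.orient_ne_zero (hXP hp) (hXP hx.2.1) (hXP hy.2.1) hx.1.symm hy.1.symm hxy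
  have hAX : A ⊆ X := fun x hx => ((hA x).1 hx).2.1
  have hAK : ∀ x ∈ A, ∀ y ∈ A, tri p x y ⊆ K := fun x hx y hy =>
    tri_subset_of_convex hK hpK ((hA x).1 hx).2.2 ((hA y).1 hy).2.2
  set B := A.filter (fun x => x = u ∨ 0 < orient p u x) with hB
  set C := A.filter (fun x => x = u ∨ 0 < orient p x u) with hC
  have hBmem : ∀ x, x ∈ B ↔ x ∈ A ∧ (x = u ∨ 0 < orient p u x) := fun x => by simp [hB]
  have hCmem : ∀ x, x ∈ C ↔ x ∈ A ∧ (x = u ∨ 0 < orient p x u) := fun x => by simp [hC]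
  have hBC : A.card + 1 ≤ B.card + C.card := by
    rw [← Finset.card_union_add_card_inter]
    refine add_le_add (Finset.card_le_card fun x hx => ?_) (Finset.card_pos.2 ⟨u, ?_⟩)
    · rw [Finset.mem_union, hBmem, hCmem]
      by_cases hxu : x = u
      · exact Or.inl ⟨hx, Or.inl hxu⟩
      · rcases (hne u hu x hx (Ne.symm hxu)).lt_or_gt with h | h
        · right; refine ⟨hx, Or.inr ?_⟩; rw [orient_swap]; linarith
        · exact Or.inl ⟨hx, Or.inr h⟩
    · simp [hBmem, hCmem, hu]
  have hBA : B ⊆ A := Finset.filter_subset _ _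
  have hCA : C ⊆ A := Finset.filter_subset _ _
  have hB0 : ∀ x ∈ B, 0 ≤ orient p u x := fun x hx => by
    rcases ((hBmem x).1 hx).2 with rfl | h
    · simp
    · exact h.le
  have hC0 : ∀ x ∈ C, 0 ≤ orient u p x := fun x hx => by
    rw [← orient_cycle]
    rcases ((hCmem x).1 hx).2 with rfl | h
    · simp
    · exact h.le
  have htB : ∀ x ∈ B, ∀ y ∈ B, 0 < orient p x y → tri p x y ⊆ {z | 0 < orient p u z} := by
    intro x hx y hy hxy z hz
    refine orient_pos_of_mem_tri hxy.ne' (hB0 x hx) (hB0 y hy) ?_ hz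
    rcases ((hBmem x).1 hx).2 with rfl | h
    · simpa using hxy
    · linarith [hB0 y hy]
  have htC : ∀ x ∈ C, ∀ y ∈ C, 0 < orient p x y → tri p x y ⊆ {z | orient p u z < 0} := by
    intro x hx y hy hxy z hz
    obtain ⟨α, β, γ, hα, hβ, hγ, h1, rfl⟩ := (mem_tri_iff_combo hxy.ne').1 hz
    change orient p u _ < 0
    rw [orient_combo _ _ _ _ _ h1]
    have hx0 := hC0 x hx
    have hy0 := hC0 y hy
    have ex : orient p u x = -orient u p x := by unfold orient; ring
    have ey : orient p u y = -orient u p y := by unfold orient; ring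
    simp only [orient_self_outer, mul_zero, zero_add, ex, ey]
    rcases ((hCmem y).1 hy).2 with rfl | h
    · have : 0 < orient y p x := by rw [← orient_cycle]; exact hxy
      simp
      positivity
    · have : 0 < orient u p y := by rw [← orient_cycle]; exact h
      have := mul_nonneg hβ.le hx0
      have : 0 < γ * orient u p y := by positivity
      linarith
  obtain ⟨F₁, hF₁, hp₁, hc₁⟩ := exists_fan (X := X) (K := K ∩ {z | 0 < orient p u z}) (A := B)
    (p := p) (starOrdered_of_first (u := u) (fun x hx y hy => hne x (hBA hx) y (hBA hy))
      (fun x hx hxu => ((hBmem x).1 hx).2.resolve_left hxu)) hp (hBA.trans hAX)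
    (fun x hx y hy hxy => Set.subset_inter (hAK x (hBA hx) y (hBA hy)) (htB x hx y hy hxy))
    (by
      intro z hz x hx y hy hxy hzt
      have h0 : 0 < orient p u z := htB x hx y hy hxy hzt
      rw [hBmem, hA]
      refine ⟨⟨?_, hz, hAK x (hBA hx) y (hBA hy) hzt⟩, Or.inr h0⟩
      rintro rfl
      simp at h0)
  obtain ⟨F₂, hF₂, hp₂, hc₂⟩ := exists_fan (X := X) (K := K ∩ {z | orient p u z < 0}) (A := C)
    (p := p) (starOrdered_of_last (u := u) (fun x hx y hy => hne x (hCA hx) y (hCA hy))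
      (fun x hx hxu => ((hCmem x).1 hx).2.resolve_left hxu)) hp (hCA.trans hAX)
    (fun x hx y hy hxy => Set.subset_inter (hAK x (hCA hx) y (hCA hy)) (htC x hx y hy hxy))
    (by
      intro z hz x hx y hy hxy hzt
      have h0 : orient p u z < 0 := htC x hx y hy hxy hzt
      rw [hCmem, hA]
      refine ⟨⟨?_, hz, hAK x (hCA hx) y (hCA hy) hzt⟩, Or.inr (by rw [orient_swap]; linarith)⟩
      rintro rfl
      simp at h0)
  obtain ⟨hU, hUc⟩ := hF₁.union hF₂ (K := K) (Set.disjoint_left.2 fun z hz hz' =>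
      lt_asymm (show 0 < orient p u z from hz.2) (show orient p u z < 0 from hz'.2))
    Set.inter_subset_left Set.inter_subset_left
  refine ⟨F₁ ∪ F₂, hU, fun T hT => (Finset.mem_union.1 hT).elim (hp₁ T) (hp₂ T), ?_⟩
  omega

open Classical in
/-- The fan from one vertex of a triangle through all the points of `X` inside it. -/
theorem exists_fan_in_tri {P X : Finset Plane} (hP : GeneralPosition P) (hXP : X ⊆ P)
    {p u v : Plane} (hp : p ∈ X) (hu : u ∈ X) (hv : v ∈ X) (h : 0 < orient p u v) :
    ∃ F, IsPacking X (tri p u v) F ∧ (∀ T ∈ F, p ∈ T) ∧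
      (X.filter (· ∈ tri p u v)).card + 1 ≤ F.card := by
  have huv : u ≠ v := by rintro rfl; simp at h
  have hu' : u ∉ tri p u v := by simp [mem_tri_iff h]
  have hv' : v ∉ tri p u v := by simp [mem_tri_iff h]
  set B := X.filter (· ∈ tri p u v) with hB
  set A := insert u (insert v B) with hA
  have hBmem : ∀ x, x ∈ B ↔ x ∈ X ∧ x ∈ tri p u v := fun x => by simp [hB]
  have hAmem : ∀ x, x ∈ A ↔ x = u ∨ x = v ∨ x ∈ X ∧ x ∈ tri p u v := fun x => by
    simp [hA, hBmem]
  have hAcard : A.card = B.card + 2 := by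
    rw [hA, Finset.card_insert_of_notMem, Finset.card_insert_of_notMem]
    · simp [hBmem, hv']
    · simp [hBmem, hu', huv]
  have hAX : A ⊆ X := by
    intro x hx
    rcases (hAmem x).1 hx with rfl | rfl | h
    exacts [hu, hv, h.1]
  have hfirst : ∀ x ∈ A, x ≠ u → 0 < orient p u x := by
    intro x hx hxu
    rcases (hAmem x).1 hx with rfl | rfl | h'
    · exact absurd rfl hxu
    · exact h
    · exact ((mem_tri_iff h).1 h'.2).1
  have hpA : ∀ x ∈ A, p ≠ x := by
    rintro x hx rfl
    by_cases hxu : p = u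
    · subst hxu; simp at h
    · simpa using hfirst p hx hxu
  have hhull : ∀ x ∈ A, x ∈ convexHull ℝ {p, u, v} := by
    intro x hx
    rcases (hAmem x).1 hx with rfl | rfl | h'
    · exact (vertices_mem_hull p x v).2.1
    · exact (vertices_mem_hull p u x).2.2
    · exact tri_subset_hull _ _ _ h'.2
  have hsub : ∀ x ∈ A, ∀ y ∈ A, tri p x y ⊆ tri p u v := fun x hx y hy =>
    tri_subset_tri (vertices_mem_hull p u v).1 (hhull x hx) (hhull y hy)
  obtain ⟨F, hF, hpF, hc⟩ := exists_fan (X := X) (K := tri p u v) (A := A) (p := p)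
    (starOrdered_of_first (u := u) (fun x hx y hy hxy =>
      hP.orient_ne_zero (hXP hp) (hXP (hAX hx)) (hXP (hAX hy)) (hpA x hx) (hpA y hy) hxy) hfirst)
    hp hAX (fun x hx y hy _ => hsub x hx y hy)
    (fun z hz x hx y hy _ hzt => (hAmem z).2 (Or.inr (Or.inr ⟨hz, hsub x hx y hy hzt⟩)))
  exact ⟨F, hF, hpF, by omega⟩

/-! ### Packings with more triangles than interior points -/

/-- For a transitive relation on a finite set, either there is a chain with `n + 1` elements or the
set is a union of `n` antichains. -/
theorem exists_chain_or_antichain_cover {α : Type*} (r : α → α → Prop)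
    (tr : ∀ x y z, r x y → r y z → r x z) (n : ℕ) :
    ∀ S : Finset α, (∀ x ∈ S, ¬ r x x) →
      (∃ C ⊆ S, C.card = n + 1 ∧ ∀ x ∈ C, ∀ y ∈ C, x ≠ y → r x y ∨ r y x) ∨
      ∃ g : α → ℕ, (∀ x ∈ S, g x < n) ∧ ∀ x ∈ S, ∀ y ∈ S, r x y → g x ≠ g y := by
  classical
  induction n with
  | zero =>
    intro S _
    rcases S.eq_empty_or_nonempty with rfl | ⟨x, hx⟩
    · right; exact ⟨fun _ => 0, by simp, by simp⟩
    · left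
      refine ⟨{x}, by simpa using hx, by simp, ?_⟩
      intro y hy z hz hyz
      rw [Finset.mem_singleton] at hy hz
      exact absurd (hy.trans hz.symm) hyz
  | succ n ih =>
    intro S irr
    -- Peel off the minimal elements, which form an antichain.
    rcases ih (S.filter fun x => ∃ y ∈ S, r y x)
      (fun x hx => irr x (Finset.mem_filter.1 hx).1) with ⟨C, hCS, hC, hch⟩ | ⟨g, hg, hgr⟩
    · left
      have hCS' : C ⊆ S := hCS.trans (Finset.filter_subset _ _)
      obtain ⟨m, hm, hmin⟩ := exists_maximal_of_trans (fun x y => r y x) (s := C)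
        (Finset.card_pos.1 (by omega)) (fun x hx => irr x (hCS' hx))
        (fun x _ y _ z _ hxy hyz => tr _ _ _ hyz hxy)
      obtain ⟨y, hy, hym⟩ := (Finset.mem_filter.1 (hCS hm)).2
      have hyC : y ∉ C := fun hyC => hmin y hyC hym
      have hyr : ∀ x ∈ C, r y x := by
        intro x hx
        by_cases hxm : x = m
        · rwa [hxm]
        · exact tr _ _ _ hym ((hch x hx m hm hxm).resolve_left (hmin x hx))
      refine ⟨insert y C, ?_, by rw [Finset.card_insert_of_notMem hyC, hC], ?_⟩
      · intro x hx
        rcases Finset.mem_insert.1 hx with rfl | hx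
        exacts [hy, hCS' hx]
      · intro x hx z hz hxz
        rcases Finset.mem_insert.1 hx with hx' | hx' <;>
          rcases Finset.mem_insert.1 hz with hz' | hz'
        · exact absurd (hx'.trans hz'.symm) hxz
        · exact Or.inl (hx' ▸ hyr z hz')
        · exact Or.inr (hz' ▸ hyr x hx')
        · exact hch x hx' z hz' hxz
    · right
      refine ⟨fun x => if ∃ y ∈ S, r y x then g x else n, fun x hx => ?_, fun x hx y hy hxy => ?_⟩
      · dsimp only
        split_ifs with h
        · have := hg x (Finset.mem_filter.2 ⟨hx, h⟩); omega
        · omega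
      · have hy' : ∃ z ∈ S, r z y := ⟨x, hx, hxy⟩
        simp only [if_pos hy']
        split_ifs with h
        · exact hgr x (Finset.mem_filter.2 ⟨hx, h⟩) y (Finset.mem_filter.2 ⟨hy, hy'⟩) hxy
        · have := hg y (Finset.mem_filter.2 ⟨hy, hy'⟩); omega

theorem not_mem_tri_vertex {a b c : Plane} (h : 0 < orient a b c) :
    a ∉ tri a b c ∧ b ∉ tri a b c ∧ c ∉ tri a b c := by
  simp [mem_tri_iff h]

theorem mem_tri_trans {b c x y z : Plane} (hxy : x ∈ tri b c y) (hyz : y ∈ tri b c z) :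
    x ∈ tri b c z :=
  tri_subset_tri (vertices_mem_hull b c z).1 (vertices_mem_hull b c z).2.1
    (tri_subset_hull _ _ _ hyz) hxy

open Classical in
/-- A chain of nested triangles on the base `b c` improves the fan: each of its members
contributes one triangle more than the number of interior points requires. -/
theorem exists_packing_of_chain {P X : Finset Plane} (hP : GeneralPosition P) (hXP : X ⊆ P)
    {b c : Plane} (hb : b ∈ X) (hc : c ∈ X) (n : ℕ) :
    ∀ (C : Finset Plane) (y : Plane), C.card = n → y ∈ X → 0 < orient b c y → C ⊆ X →
      (∀ x ∈ C, x ∈ tri b c y) →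
      (∀ x ∈ C, ∀ z ∈ C, x ≠ z → x ∈ tri b c z ∨ z ∈ tri b c x) →
      ∃ F, IsPacking X (tri b c y) F ∧ (∀ T ∈ F, b ∈ T ∨ c ∈ T) ∧
        (X.filter (· ∈ tri b c y)).card + n + 1 ≤ F.card := by
  induction n with
  | zero =>
    intro C y _ hy h _ _ _
    obtain ⟨F, hF, hbF, hcard⟩ := exists_fan_in_tri hP hXP hb hc hy h
    exact ⟨F, hF, fun T hT => Or.inl (hbF T hT), by omega⟩
  | succ n ih =>
    intro C y hC hy h hCX hCt hch
    have hpos : ∀ x ∈ C, 0 < orient b c x := fun x hx => ((mem_tri_iff h).1 (hCt x hx)).1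
    obtain ⟨z, hz, hmax⟩ := exists_maximal_of_trans (fun x z => x ∈ tri b c z) (s := C)
      (Finset.card_pos.1 (by omega)) (fun x hx => (not_mem_tri_vertex (hpos x hx)).2.2)
      (fun x _ y _ z _ => mem_tri_trans)
    have hzX := hCX hz
    have hzt := hCt z hz
    have hzm := (mem_tri_iff h).1 hzt
    have h2 : 0 < orient b z y := by rw [← orient_cycle, ← orient_cycle]; exact hzm.2.2
    obtain ⟨F₁, hF₁, hi₁, hc₁⟩ := ih (C.erase z) z (by rw [Finset.card_erase_of_mem hz, hC]; rfl)
      hzX (hpos z hz) ((Finset.erase_subset _ _).trans hCX)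
      (fun x hx => (hch x (Finset.mem_of_mem_erase hx) z hz
        (Finset.ne_of_mem_erase hx)).resolve_right (hmax x (Finset.mem_of_mem_erase hx)))
      (fun x hx w hw => hch x (Finset.mem_of_mem_erase hx) w (Finset.mem_of_mem_erase hw))
    obtain ⟨F₂, hF₂, hi₂, hc₂⟩ := exists_fan_in_tri hP hXP hb hzX hy h2
    obtain ⟨F₃, hF₃, hi₃, hc₃⟩ := exists_fan_in_tri hP hXP hc hy hzX hzm.2.1
    obtain ⟨d12, d13, d23⟩ := disjoint_subtriangles h hzt
    obtain ⟨hbh, hch', hyh⟩ := vertices_mem_hull b c y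
    have hzh := tri_subset_hull _ _ _ hzt
    have s1 : tri b c z ⊆ tri b c y := tri_subset_tri hbh hch' hzh
    have s2 : tri b z y ⊆ tri b c y := tri_subset_tri hbh hzh hyh
    have s3 : tri c y z ⊆ tri b c y := tri_subset_tri hch' hyh hzh
    obtain ⟨hU, hUc⟩ := hF₂.union hF₃ (K := tri b z y ∪ tri c y z) d23
      Set.subset_union_left Set.subset_union_right
    obtain ⟨hV, hVc⟩ := hF₁.union hU (K := tri b c y) (Set.disjoint_union_right.2 ⟨d12, d13⟩) s1
      (Set.union_subset s2 s3)
    refine ⟨_, hV, ?_, ?_⟩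
    · intro T hT
      rcases Finset.mem_union.1 hT with hT | hT
      · exact hi₁ T hT
      · exact (Finset.mem_union.1 hT).imp (hi₂ T) (hi₃ T)
    · have hcov : X.filter (· ∈ tri b c y) ⊆ insert z (X.filter (· ∈ tri b c z) ∪
          (X.filter (· ∈ tri b z y) ∪ X.filter (· ∈ tri c y z))) := by
        intro x hx
        obtain ⟨hxX, hxt⟩ := Finset.mem_filter.1 hx
        simp only [Finset.mem_insert, Finset.mem_union, Finset.mem_filter, hxX, true_and]
        by_cases hxz : x = z
        · exact Or.inl hxz
        right
        have hv := not_mem_tri_vertex h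
        have ne : ∀ w ∈ X, w ∉ tri b c y → orient z w x ≠ 0 := fun w hw hwt =>
          hP.orient_ne_zero (hXP hzX) (hXP hw) (hXP hxX) (by rintro rfl; exact hwt hzt)
            (Ne.symm hxz) (by rintro rfl; exact hwt hxt)
        exact mem_subtriangles h hzt hxt (ne b hb hv.1) (ne c hc hv.2.1) (ne y hy hv.2.2)
      have := Finset.card_le_card hcov
      have := Finset.card_insert_le z (X.filter (· ∈ tri b c z) ∪
          (X.filter (· ∈ tri b z y) ∪ X.filter (· ∈ tri c y z)))
      have := Finset.card_union_le (X.filter (· ∈ tri b c z))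
          (X.filter (· ∈ tri b z y) ∪ X.filter (· ∈ tri c y z))
      have := Finset.card_union_le (X.filter (· ∈ tri b z y)) (X.filter (· ∈ tri c y z))
      omega

/-- Of two points of the triangle `a b c`, if neither is separated from the base `b c` by the
other one, then this happens for the base `c a`. -/
theorem mem_tri_other_base {a b c x y : Plane} (h : 0 < orient a b c) (hx : x ∈ tri a b c)
    (hy : y ∈ tri a b c) (hbne : orient b x y ≠ 0) (hcne : orient c x y ≠ 0)
    (h1 : x ∉ tri b c y) (h2 : y ∉ tri b c x) : x ∈ tri c a y ∨ y ∈ tri c a x := by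
  obtain ⟨α, β, γ, hα, hβ, hγ, hs, hxx⟩ := (mem_tri_iff_combo h.ne').1 hx
  have key : α * orient a x y + β * orient b x y + γ * orient c x y = 0 := by
    have := orient_combo x y a b c hs
    rw [← hxx, orient_self_outer] at this
    rw [← orient_cycle a x y, ← orient_cycle b x y, ← orient_cycle c x y]
    linarith
  obtain ⟨kx1, kx2, kx3⟩ := (mem_tri_iff h).1 hx
  obtain ⟨ky1, ky2, ky3⟩ := (mem_tri_iff h).1 hy
  rw [mem_tri_iff ky2] at h1
  rw [mem_tri_iff kx2] at h2
  rw [mem_tri_iff ky3, mem_tri_iff kx3]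
  have e1 : orient c y x = -orient c x y := orient_swap _ _ _
  have e2 : orient a y x = -orient a x y := orient_swap _ _ _
  have e3 : orient y b x = orient b x y := (orient_cycle _ _ _).symm
  have e4 : orient x b y = -orient b x y := by unfold orient; ring
  have e5 : orient y c x = orient c x y := (orient_cycle _ _ _).symm
  have e6 : orient x c y = -orient c x y := by unfold orient; ring
  rw [e1, e3] at h1
  rw [e4] at h2
  rw [e2, e5, e6]
  rcases hbne.lt_or_gt with hb | hb <;> rcases hcne.lt_or_gt with hc | hc
  · right
    have := mul_neg_of_pos_of_neg hβ hb
    have := mul_neg_of_pos_of_neg hγ hc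
    exact ⟨ky3, pos_of_mul_pos_right (a := α) (by linarith) hα.le, by linarith⟩
  · exact absurd ⟨ky2, hc, by linarith⟩ h2
  · exact absurd ⟨kx2, by linarith, hb⟩ h1
  · left
    have := mul_pos hβ hb
    have := mul_pos hγ hc
    refine ⟨kx3, pos_of_mul_pos_right (a := α) ?_ hα.le, hc⟩
    linarith

open Classical in
/-- A triangle with `k` interior points has a packing of at least `k + √k + 1` triangles, each
incident to one of its corners. If no chain for the base `b c` has `√k` members, then some
antichain has that many, and it is a chain for the base `c a`. -/
theorem exists_packing_incident_to_corners {P X : Finset Plane} (hP : GeneralPosition P)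
    (hXP : X ⊆ P) {a b c : Plane} (ha : a ∈ X) (hb : b ∈ X) (hc : c ∈ X)
    (h : 0 < orient a b c) :
    ∃ F, ∃ m : ℕ, IsPacking X (tri a b c) F ∧ (∀ T ∈ F, a ∈ T ∨ b ∈ T ∨ c ∈ T) ∧
      (X.filter (· ∈ tri a b c)).card ≤ m ^ 2 ∧
      (X.filter (· ∈ tri a b c)).card + m + 1 ≤ F.card := by
  set S := X.filter (· ∈ tri a b c) with hS
  have hSm : ∀ x, x ∈ S ↔ x ∈ X ∧ x ∈ tri a b c := fun x => by simp [hS]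
  have hbc : 0 < orient b c a := by rwa [orient_cycle]
  have hca : 0 < orient c a b := by rwa [orient_cycle]
  have tbc : tri b c a = tri a b c := tri_rotate a b c
  have tca : tri c a b = tri a b c := by rw [← tbc]; exact tri_rotate b c a
  have hv := not_mem_tri_vertex h
  rcases Nat.eq_zero_or_pos S.card with h0 | h0
  · obtain ⟨F, hF, hi, hcard⟩ := exists_fan_in_tri hP hXP ha hb hc h
    refine ⟨F, 0, hF, fun T hT => Or.inl (hi T hT), by omega, by omega⟩
  set n := Nat.sqrt (S.card - 1) with hn
  have hn1 : n * n < S.card := by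
    have := Nat.sqrt_le (S.card - 1)
    rw [← hn] at this
    omega
  have hn2 : S.card ≤ (n + 1) ^ 2 := by
    have := Nat.lt_succ_sqrt (S.card - 1)
    rw [← hn, Nat.succ_eq_add_one] at this
    rw [pow_two]
    omega
  have hpos : ∀ x ∈ S, 0 < orient b c x := fun x hx => ((mem_tri_iff h).1 ((hSm x).1 hx).2).2.1
  rcases exists_chain_or_antichain_cover (fun x y => x ∈ tri b c y) (fun _ _ _ => mem_tri_trans) n S
    (fun x hx => (not_mem_tri_vertex (hpos x hx)).2.2) with ⟨C, hCS, hC, hch⟩ | ⟨g, hg, hgr⟩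
  · obtain ⟨F, hF, hi, hcard⟩ := exists_packing_of_chain hP hXP hb hc (n + 1) C a hC ha hbc
      (fun x hx => ((hSm x).1 (hCS hx)).1)
      (fun x hx => by rw [tbc]; exact ((hSm x).1 (hCS hx)).2) hch
    rw [tbc] at hF hcard
    exact ⟨F, n + 1, hF, fun T hT => Or.inr (hi T hT), hn2, hcard⟩
  · obtain ⟨i, hi, hcard⟩ := Finset.exists_lt_card_fiber_of_mul_lt_card_of_maps_to
      (s := S) (t := Finset.range n) (f := g) (n := n) (fun x hx => Finset.mem_range.2 (hg x hx))
      (by simpa using hn1)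
    obtain ⟨C, hCS, hC⟩ := Finset.exists_subset_card_eq (Nat.succ_le_of_lt hcard)
    have hCm : ∀ x ∈ C, x ∈ S ∧ g x = i := fun x hx => Finset.mem_filter.1 (hCS hx)
    obtain ⟨F, hF, hi, hcard⟩ := exists_packing_of_chain hP hXP hc ha (n + 1) C b hC hb hca
      (fun x hx => ((hSm x).1 (hCm x hx).1).1)
      (fun x hx => by rw [tca]; exact ((hSm x).1 (hCm x hx).1).2)
      (by
        intro x hx z hz hxz
        obtain ⟨hxS, hxi⟩ := hCm x hx
        obtain ⟨hzS, hzi⟩ := hCm z hz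
        obtain ⟨hxX, hxt⟩ := (hSm x).1 hxS
        obtain ⟨hzX, hzt⟩ := (hSm z).1 hzS
        have ne : ∀ w ∈ X, w ∉ tri a b c → orient w x z ≠ 0 := fun w hw hwt =>
          hP.orient_ne_zero (hXP hw) (hXP hxX) (hXP hzX) (by rintro rfl; exact hwt hxt)
            (by rintro rfl; exact hwt hzt) hxz
        exact mem_tri_other_base h hxt hzt (ne b hb hv.2.1) (ne c hc hv.2.2)
          (fun hcon => hgr x hxS z hzS hcon (hxi.trans hzi.symm))
          (fun hcon => hgr z hzS x hxS hcon (hzi.trans hxi.symm)))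
    rw [tca] at hF hcard
    exact ⟨F, n + 1, hF, fun T hT => (hi T hT).elim (fun h => Or.inr (Or.inr h)) Or.inl,
      hn2, hcard⟩

/-! ### Triangulating a convex hull by a fan -/

theorem exists_hull_vertices (U : Finset Plane) : ∃ H ⊆ U,
    convexHull ℝ (H : Set Plane) = convexHull ℝ (U : Set Plane) ∧
      ∀ x ∈ H, Convex ℝ (convexHull ℝ (U : Set Plane) \ {x}) := by
  have hsub : (convexHull ℝ (U : Set Plane)).extremePoints ℝ ⊆ U :=
    extremePoints_convexHull_subset
  have hfin := U.finite_toSet.subset hsub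
  refine ⟨hfin.toFinset, fun x hx => hsub (hfin.mem_toFinset.1 hx), ?_, ?_⟩
  · rw [hfin.coe_toFinset, ← (hfin.isClosed_convexHull ℝ).closure_eq]
    exact closure_convexHull_extremePoints (U.finite_toSet.isCompact_convexHull ℝ)
      (convex_convexHull ℝ _)
  · intro x hx
    rw [Set.Finite.mem_toFinset] at hx
    exact ((convex_convexHull ℝ (U : Set Plane)).mem_extremePoints_iff_convex_sdiff.1 hx).2

/-- The lexicographically smallest point of a set in general position sees the other points in a
linear angular order. -/
theorem exists_starOrdered_erase [DecidableEq Plane] {P H : Finset Plane} (hP : GeneralPosition P)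
    (hHP : H ⊆ P) (hH : H.Nonempty) : ∃ a ∈ H, StarOrdered a (H.erase a) := by
  obtain ⟨a, ha, hmin⟩ := H.exists_min_image (fun x : Plane => toLex (x 0, x 1)) hH
  refine ⟨a, ha, ?_, ?_⟩
  · intro x hx y hy hxy
    rw [Finset.mem_erase] at hx hy
    exact hP.orient_ne_zero (hHP ha) (hHP hx.2) (hHP hy.2) hx.1.symm hy.1.symm hxy
  · have hlex : ∀ x ∈ H.erase a, a 0 < x 0 ∨ a 0 = x 0 ∧ a 1 < x 1 := by
      intro x hx
      rw [Finset.mem_erase] at hx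
      rcases Prod.Lex.le_iff.1 (hmin x hx.2) with h | ⟨h, h'⟩
      · exact Or.inl h
      · refine Or.inr ⟨h, lt_of_le_of_ne h' fun h'' => hx.1 ?_⟩
        ext i
        fin_cases i
        exacts [h.symm, h''.symm]
    intro x hx y hy z hz hxy hyz
    have key : ∀ x ∈ H.erase a, ∀ y ∈ H.erase a, 0 < orient a x y → 0 < x 0 - a 0 := by
      intro x hx y hy hxy
      rcases hlex x hx with h | ⟨h, h'⟩
      · linarith
      · exfalso
        unfold orient at hxy
        have hy0 : 0 ≤ y 0 - a 0 := by rcases hlex y hy with h | h <;> linarith [h]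
        have := mul_nonneg (sub_nonneg.2 h'.le) hy0
        rw [← h, sub_self, zero_mul] at hxy
        linarith
    have hx0 := key x hx y hy hxy
    have hy0 := key y hy z hz hyz
    have hz0 : 0 ≤ z 0 - a 0 := by
      rcases hlex z hz with h | h
      · linarith
      · linarith [h.1]
    have hpl : (y 0 - a 0) * orient a x z =
        (x 0 - a 0) * orient a y z + (z 0 - a 0) * orient a x y := by
      unfold orient; ring
    have h1 := mul_pos hx0 hyz
    have h2 := mul_nonneg hz0 hxy.le
    exact pos_of_mul_pos_right (a := y 0 - a 0) (by linarith) hy0.le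

/-- The fan from a suitable vertex triangulates the convex hull of points in convex position. -/
theorem exists_triangulating_fan [DecidableEq Plane] {P H : Finset Plane} (hP : GeneralPosition P)
    (hHP : H ⊆ P) (hH : H.Nonempty)
    (hext : ∀ x ∈ H, Convex ℝ (convexHull ℝ (H : Set Plane) \ {x})) :
    ∃ a ∈ H, StarOrdered a (H.erase a) ∧ ∀ x ∈ P, x ∈ convexHull ℝ (H : Set Plane) → x ∉ H →
      ∃ e ∈ consecutive a (H.erase a), x ∈ tri a e.1 e.2 := by
  obtain ⟨a, ha, hstar⟩ := exists_starOrdered_erase hP hHP hH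
  refine ⟨a, ha, hstar, fun x hxP hxH hxn => ?_⟩
  have hA : (H.erase a).Nonempty := by
    by_contra hcon
    rw [Finset.not_nonempty_iff_eq_empty, Finset.erase_eq_empty_iff] at hcon
    rcases hcon with rfl | rfl
    · simp at ha
    · simp at hxH hxn
      exact hxn hxH
  have hconv : ∀ p q : Plane, (∀ y ∈ H, 0 ≤ orient p q y) → 0 ≤ orient p q x := fun p q hy =>
    convexHull_min (s := (H : Set Plane)) (t := {x | 0 ≤ orient p q x}) hy
      (convex_orient_nonneg p q) hxH
  have hax : a ≠ x := by rintro rfl; exact hxn ha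
  have hne : ∀ u ∈ H.erase a, orient a u x ≠ 0 := fun u hu => by
    rw [Finset.mem_erase] at hu
    exact hP.orient_ne_zero (hHP ha) (hHP hu.2) hxP hu.1.symm hax
      (by rintro rfl; exact hxn hu.2)
  have hcases : ∀ y ∈ H, y = a ∨ y ∈ H.erase a := fun y hy => by
    by_cases h : y = a
    · exact Or.inl h
    · exact Or.inr (Finset.mem_erase.2 ⟨h, hy⟩)
  obtain ⟨m, hm, hmf⟩ := hstar.exists_first hA
  obtain ⟨M, hM, hMl⟩ := hstar.exists_last hA
  have hmx : 0 < orient a m x := by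
    refine lt_of_le_of_ne (hconv a m fun y hy => ?_) (hne m hm).symm
    rcases hcases y hy with rfl | hy
    · simp
    · by_cases hym : y = m
      · simp [hym]
      · exact (hmf y hy hym).le
  have hMx : 0 < orient M a x := by
    refine lt_of_le_of_ne (hconv M a fun y hy => ?_) ?_
    · rcases hcases y hy with rfl | hy
      · simp
      · by_cases hym : y = M
        · simp [hym]
        · rw [← orient_cycle]
          exact (hMl y hy hym).le
    · intro h0
      apply hne M hM
      rw [orient_swap, ← orient_cycle a x M, ← orient_cycle x M a, ← h0, neg_zero]
  obtain ⟨u, hu, hul⟩ := (hstar.mono (Finset.filter_subset (fun w => 0 < orient a w x)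
    _)).exists_last ⟨m, Finset.mem_filter.2 ⟨hm, hmx⟩⟩
  obtain ⟨huA, hux⟩ := Finset.mem_filter.1 hu
  have huM : u ≠ M := by
    rintro rfl
    have : orient u a x = -orient a u x := by unfold orient; ring
    linarith
  obtain ⟨v, hv⟩ := hstar.exists_succ huA hM (hMl u huA huM)
  obtain ⟨⟨-, hvA⟩, huv, hcons⟩ := mem_consecutive.1 hv
  have hvx : 0 < orient v a x := by
    have hne' := hne v hvA
    have hswap : orient v a x = -orient a v x := by unfold orient; ring
    rcases hne'.lt_or_gt with h0 | h0
    · linarith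
    · exfalso
      have := hul v (Finset.mem_filter.2 ⟨hvA, h0⟩) (by rintro rfl; simp at huv)
      rw [orient_swap] at this
      have h1 : 0 < orient a u v := huv
      linarith
  -- No vertex lies inside the triangle formed by `a` and two other vertices.
  have hpos : ∀ w ∈ H, ∀ y ∈ H, ∀ z ∈ H, w ≠ a → w ≠ y → w ≠ z → w ∉ tri a y z := by
    intro w hw y hy z hz h1 h2 h3 hwt
    have hmem : ∀ p ∈ H, w ≠ p → p ∈ convexHull ℝ (H : Set Plane) \ {w} := fun p hp hwp =>
      ⟨subset_convexHull _ _ hp, fun h => hwp h.symm⟩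
    exact (tri_subset_of_convex (hext w hw) (hmem a ha h1) (hmem y hy h2) (hmem z hz h3) hwt).2 rfl
  have huvx : 0 < orient u v x := by
    have huH := Finset.mem_of_mem_erase huA
    have hvH := Finset.mem_of_mem_erase hvA
    have hua := Finset.ne_of_mem_erase huA
    have hva := Finset.ne_of_mem_erase hvA
    have hneuv : u ≠ v := by rintro rfl; simp at huv
    refine lt_of_le_of_ne (hconv u v fun w hw => ?_) ?_
    · rcases hcases w hw with rfl | hwA
      · rw [orient_cycle]; exact huv.le
      · by_cases hwu : w = u
        · simp [hwu]
        by_cases hwv : w = v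
        · simp [hwv]
        by_contra! hneg
        rcases hstar.pos_or_pos hwA huA hwu with h0 | h0
        · have hwv' : 0 < orient a w v := hstar.trans w hwA u huA v hvA h0 huv
          refine hpos u huH w hw v hvH hua (Ne.symm hwu) hneuv ((mem_tri_iff hwv').2 ⟨h0, ?_, ?_⟩)
          · have : orient w v u = -orient u v w := by unfold orient; ring
            linarith
          · rw [← orient_cycle]; exact huv
        · have hvw : 0 < orient a v w := by
            refine (hstar.pos_or_pos hwA hvA hwv).resolve_left fun h1 => hcons w hwA ⟨h0, h1⟩
          refine hpos v hvH u huH w hw hva (Ne.symm hneuv) (Ne.symm hwv)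
            ((mem_tri_iff h0).2 ⟨huv, ?_, ?_⟩)
          · have : orient u w v = -orient u v w := orient_swap _ _ _
            linarith
          · rw [← orient_cycle]; exact hvw
    · exact (hP.orient_ne_zero (hHP huH) (hHP hvH) hxP hneuv (by rintro rfl; exact hxn huH)
        (by rintro rfl; exact hxn hvH)).symm
  exact ⟨(u, v), hv, (mem_tri_iff huv).2 ⟨hux, huvx, hvx⟩⟩

/-! ### Counting monochromatic triangles at a point -/

open Classical in
/-- The number of the monochromatic triangles with at most `s` interior points that have `p` as a
vertex. -/
noncomputable def triangleDegree {c : ℕ} (P : Finset Plane) (φ : Plane → Fin c) (s : ℕ)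
    (p : Plane) : ℕ :=
  ((monoTriangles P φ s).filter (p ∈ ·)).card

theorem mem_interiorPoints {P T : Finset Plane} {x : Plane} :
    x ∈ interiorPoints P T ↔ x ∈ P ∧ x ∈ openTriangle T := by
  simp [interiorPoints]

theorem mem_monoTriangles {c s : ℕ} {P T : Finset Plane} {φ : Plane → Fin c} :
    T ∈ monoTriangles P φ s ↔
      (T ⊆ P ∧ T.card = 3) ∧ Monochromatic φ T ∧ (interiorPoints P T).card ≤ s := by
  simp [monoTriangles, Finset.mem_powersetCard]

open Classical in
/-- Every triangle of a packing on one color class that is not counted has at least `s + 1`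
interior points, all of other colors, and these sets of interior points are disjoint. -/
theorem IsPacking.mul_card_le {c s : ℕ} {P : Finset Plane} {φ : Plane → Fin c} {j : Fin c}
    {K : Set Plane} {F : Finset (Finset Plane)} (hF : IsPacking (P.filter (φ · = j)) K F) :
    (s + 1) * F.card + (P.filter fun x => x ∈ K ∧ φ x = j).card ≤
      (s + 1) * (F.filter (· ∈ monoTriangles P φ s)).card + (P.filter (· ∈ K)).card := by
  have hbad : ∀ T ∈ F.filter (· ∉ monoTriangles P φ s), s + 1 ≤ (interiorPoints P T).card := by
    intro T hT
    obtain ⟨hTF, hTm⟩ := Finset.mem_filter.1 hT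
    by_contra! hlt
    refine hTm (mem_monoTriangles.2 ⟨⟨(hF.subset T hTF).trans (Finset.filter_subset _ _),
      hF.card_eq T hTF⟩, ⟨j, fun p hp => ?_⟩, by omega⟩)
    exact (Finset.mem_filter.1 (hF.subset T hTF hp)).2
  have hsum := Finset.sum_le_sum hbad
  rw [Finset.sum_const, smul_eq_mul] at hsum
  rw [← Finset.card_biUnion] at hsum
  · have hsub : (F.filter (· ∉ monoTriangles P φ s)).biUnion (interiorPoints P) ⊆
        P.filter (fun x => x ∈ K ∧ φ x ≠ j) := by
      intro x hx
      obtain ⟨T, hT, hxT⟩ := Finset.mem_biUnion.1 hx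
      obtain ⟨hTF, -⟩ := Finset.mem_filter.1 hT
      obtain ⟨hxP, hxt⟩ := mem_interiorPoints.1 hxT
      refine Finset.mem_filter.2 ⟨hxP, hF.region T hTF hxt, fun hxj => ?_⟩
      exact hF.empty T hTF x (Finset.mem_filter.2 ⟨hxP, hxj⟩) hxt
    have h1 := Finset.card_le_card hsub
    have h2 := Finset.card_filter_add_card_filter_not (s := P.filter (· ∈ K)) (fun x => φ x = j)
    simp only [Finset.filter_filter] at h2
    have h3 := Finset.card_filter_add_card_filter_not (s := F) (· ∈ monoTriangles P φ s)
    have h4 : (s + 1) * F.card = (s + 1) * (F.filter (· ∈ monoTriangles P φ s)).card +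
        (F.filter (· ∉ monoTriangles P φ s)).card * (s + 1) := by rw [← h3]; ring
    simp only [ne_eq] at h1
    omega
  · intro T hT T' hT' hne
    have hd := hF.disjoint T (Finset.mem_filter.1 hT).1 T' (Finset.mem_filter.1 hT').1 hne
    exact Finset.disjoint_left.2 fun x hx hx' => Set.disjoint_left.1 hd
      (mem_interiorPoints.1 hx).2 (mem_interiorPoints.1 hx').2

open Classical in
/-- In a convex region where the color of `p` is over-represented, `p` has large degree. -/
theorem mul_card_color_le {c s : ℕ} (hc : c = s + 2) {P : Finset Plane} (hP : GeneralPosition P)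
    (φ : Plane → Fin c) {K : Set Plane} (hK : Convex ℝ K) {p : Plane} (hp : p ∈ P)
    (hpK : p ∈ K) :
    c * (P.filter fun x => x ∈ K ∧ φ x = φ p).card ≤
      (P.filter (· ∈ K)).card + (s + 1) * (triangleDegree P φ s p + 2) := by
  obtain ⟨F, hF, hpF, hcard⟩ := exists_packing_around hP (Finset.filter_subset (φ · = φ p) P) hK
    (Finset.mem_filter.2 ⟨hp, rfl⟩) hpK
  have h1 := hF.mul_card_le (s := s)
  have h2 : (F.filter (· ∈ monoTriangles P φ s)).card ≤ triangleDegree P φ s p := by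
    refine Finset.card_le_card fun T hT => ?_
    obtain ⟨hTF, hTm⟩ := Finset.mem_filter.1 hT
    exact Finset.mem_filter.2 ⟨hTm, hpF T hTF⟩
  have h3 : (P.filter (φ · = φ p)).filter (· ∈ K) = P.filter fun x => x ∈ K ∧ φ x = φ p := by
    rw [Finset.filter_filter]
    simp only [and_comm]
  rw [h3] at hcard
  subst hc
  nlinarith

open Classical in
/-- A monochromatic triangle with `k` interior points of its color and roughly `(c - 1) * k`
interior points of other colors has a corner of degree of order `√k`. -/
theorem exists_corner_degree_bound {c s : ℕ} {P : Finset Plane} (hP : GeneralPosition P)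
    (φ : Plane → Fin c) {j : Fin c} {x y z : Plane} (hx : x ∈ P) (hy : y ∈ P) (hz : z ∈ P)
    (hxj : φ x = j) (hyj : φ y = j) (hzj : φ z = j) (h : 0 < orient x y z) :
    ∃ m : ℕ, (P.filter fun w => w ∈ tri x y z ∧ φ w = j).card ≤ m ^ 2 ∧
      (s + 1) * ((P.filter fun w => w ∈ tri x y z ∧ φ w = j).card + m + 1) +
        (P.filter fun w => w ∈ tri x y z ∧ φ w = j).card ≤
      (s + 1) * (triangleDegree P φ s x + triangleDegree P φ s y + triangleDegree P φ s z) +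
        (P.filter (· ∈ tri x y z)).card := by
  obtain ⟨F, m, hF, hi, hm, hcard⟩ := exists_packing_incident_to_corners hP
    (Finset.filter_subset (φ · = j) P) (Finset.mem_filter.2 ⟨hx, hxj⟩)
    (Finset.mem_filter.2 ⟨hy, hyj⟩) (Finset.mem_filter.2 ⟨hz, hzj⟩) h
  have h1 := hF.mul_card_le (s := s)
  have h3 : (P.filter (φ · = j)).filter (· ∈ tri x y z) =
      P.filter fun w => w ∈ tri x y z ∧ φ w = j := by
    rw [Finset.filter_filter]
    simp only [and_comm]
  rw [h3] at hm hcard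
  have h2 : (F.filter (· ∈ monoTriangles P φ s)).card ≤
      triangleDegree P φ s x + triangleDegree P φ s y + triangleDegree P φ s z := by
    have hsub : F.filter (· ∈ monoTriangles P φ s) ⊆ ((monoTriangles P φ s).filter (x ∈ ·) ∪
        (monoTriangles P φ s).filter (y ∈ ·)) ∪ (monoTriangles P φ s).filter (z ∈ ·) := by
      intro T hT
      obtain ⟨hTF, hTm⟩ := Finset.mem_filter.1 hT
      have := hi T hTF
      simp only [Finset.mem_union, Finset.mem_filter, hTm, true_and]
      tauto
    exact (Finset.card_le_card hsub).trans ((Finset.card_union_le _ _).trans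
      (Nat.add_le_add_right (Finset.card_union_le _ _) _))
  refine ⟨m, hm, ?_⟩
  have h4 := Nat.mul_le_mul_left (s + 1) hcard
  have h5 := Nat.mul_le_mul_left (s + 1) h2
  omega

theorem sum_triangleDegree_le {c s : ℕ} (P : Finset Plane) (φ : Plane → Fin c) :
    ∑ p ∈ P, triangleDegree P φ s p ≤ 3 * (monoTriangles P φ s).card := by
  classical
  have h : ∑ p ∈ P, triangleDegree P φ s p =
      ∑ T ∈ monoTriangles P φ s, (P.filter (· ∈ T)).card := by
    simp only [triangleDegree, Finset.card_filter]
    exact Finset.sum_comm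
  rw [h, mul_comm]
  refine Finset.sum_le_card_nsmul _ _ _ fun T hT => ?_
  rw [← (mem_monoTriangles.1 hT).1.2]
  exact Finset.card_le_card fun x hx => (Finset.mem_filter.1 hx).2

/-! ### Many points of large degree -/

/-- If no color is over-represented, then no color is under-represented. -/
theorem sub_le_mul_of_forall_mul_le {c : ℕ} {f : Fin c → ℝ} {q D : ℝ} (hf : ∑ i, f i = q)
    (h : ∀ i, c * f i ≤ q + D) (j : Fin c) : q - (c - 1) * D ≤ c * f j := by
  have h1 : ∑ i ∈ Finset.univ.erase j, (c * f i) ≤ (c - 1) * (q + D) := by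
    refine (Finset.sum_le_card_nsmul _ _ _ fun i _ => h i).trans_eq ?_
    rw [Finset.card_erase_of_mem (Finset.mem_univ j), Finset.card_univ, Fintype.card_fin,
      nsmul_eq_mul, Nat.cast_sub (by have := j.pos; omega), Nat.cast_one]
  have h2 := Finset.add_sum_erase Finset.univ (fun i => c * f i) (Finset.mem_univ j)
  have h3 : ∑ i, (c * f i) = c * q := by rw [← Finset.mul_sum, hf]
  linarith

open Classical in
theorem sum_card_color {c : ℕ} (P : Finset Plane) (φ : Plane → Fin c) (K : Set Plane) :
    ∑ i, ((P.filter fun x => x ∈ K ∧ φ x = i).card : ℝ) = ((P.filter (· ∈ K)).card : ℝ) := by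
  rw [Finset.card_eq_sum_card_fiberwise (f := φ) (t := Finset.univ) (by simp)]
  push_cast
  simp only [Finset.filter_filter]

open Classical in
/-- A positive proportion of the points have degree at least of order `n ^ (1/3)`. -/
theorem card_le_mul_card_heavy {c s : ℕ} (hc : c = s + 2) {P : Finset Plane}
    (hP : GeneralPosition P) (φ : Plane → Fin c) {t : ℝ} (ht : 2 ≤ t)
    (hn : 64 * (c : ℝ) ^ 6 * t ^ 3 ≤ P.card) :
    (P.card : ℝ) ≤ 8 * (c : ℝ) ^ 2 * (P.filter fun p => t ≤ triangleDegree P φ s p).card := by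
  set V := P.filter fun p => t ≤ (triangleDegree P φ s p : ℝ) with hV
  by_contra! hlt
  -- `D` is the excess of a color in a convex region that forces its points to be of large degree.
  set D : ℝ := (s + 1) * (t + 2) with hD
  have hc2 : (2 : ℝ) ≤ c := by rw [hc]; push_cast; linarith [Nat.cast_nonneg (α := ℝ) s]
  have hsc : (s : ℝ) + 1 = c - 1 := by rw [hc]; push_cast; ring
  have hc0 : (0 : ℝ) < c := by linarith
  have hD0 : 0 < D := by positivity
  -- Numerical bounds, in terms of `y = n / c` and `w = c ^ 5 * t ^ 3`.
  obtain ⟨y, hy⟩ : ∃ y : ℝ, (P.card : ℝ) = c * y := ⟨P.card / c, by field_simp⟩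
  set w : ℝ := (c : ℝ) ^ 5 * t ^ 3 with hw
  have hwy : 64 * w ≤ y := by
    refine le_of_mul_le_mul_left (a := (c : ℝ)) ?_ hc0
    rw [← hy]
    refine le_trans (le_of_eq ?_) hn
    rw [hw]; ring
  have hVy : 8 * (c * (V.card : ℝ)) < y := by
    refine lt_of_mul_lt_mul_left (a := (c : ℝ)) ?_ hc0.le
    rw [← hy]
    refine lt_of_eq_of_lt ?_ hlt
    ring
  have hV0 : (0 : ℝ) ≤ V.card := Nat.cast_nonneg _
  have hVc : 2 * (V.card : ℝ) ≤ c * V.card := mul_le_mul_of_nonneg_right hc2 hV0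
  have hDt : D ≤ 2 * c * t := by
    rw [hD, hsc]
    nlinarith
  have ht3 : 4 * t ≤ t ^ 3 := by nlinarith [mul_nonneg (sub_nonneg.2 ht) (by linarith : 0 ≤ t)]
  have hcD : c * D ≤ w / 16 := by
    have h1 : c * D ≤ c * (2 * c * t) := mul_le_mul_of_nonneg_left hDt hc0.le
    have h2 : (8 : ℝ) ≤ (c : ℝ) ^ 3 := by
      calc (8 : ℝ) = 2 ^ 3 := by norm_num
        _ ≤ (c : ℝ) ^ 3 := pow_le_pow_left₀ (by norm_num) hc2 3
    have h3 : (8 : ℝ) * (4 * t) ≤ (c : ℝ) ^ 3 * t ^ 3 :=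
      mul_le_mul h2 ht3 (by linarith) (by positivity)
    have h4 := mul_le_mul_of_nonneg_left h3 (by positivity : 0 ≤ (c : ℝ) ^ 2 / 16)
    calc c * D ≤ c * (2 * c * t) := h1
      _ = (c : ℝ) ^ 2 / 16 * (8 * (4 * t)) := by ring
      _ ≤ (c : ℝ) ^ 2 / 16 * ((c : ℝ) ^ 3 * t ^ 3) := h4
      _ = w / 16 := by rw [hw]; ring
  have hcDD : c * D * (3 * t + D) ^ 2 ≤ 16 * w := by
    have h1 : c * D ≤ c * (2 * c * t) := mul_le_mul_of_nonneg_left hDt hc0.le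
    have h2 : 3 * t + D ≤ 4 * c * t := by nlinarith
    have h3 : (3 * t + D) ^ 2 ≤ (4 * c * t) ^ 2 := pow_le_pow_left₀ (by positivity) h2 2
    calc c * D * (3 * t + D) ^ 2 ≤ c * (2 * c * t) * (4 * c * t) ^ 2 :=
          mul_le_mul h1 h3 (by positivity) (by positivity)
      _ = 32 * (c : ℝ) ^ 4 * t ^ 3 := by ring
      _ ≤ 16 * c * (c : ℝ) ^ 4 * t ^ 3 := by gcongr; linarith
      _ = 16 * w := by rw [hw]; ring
  have hw0 : 0 < w := by positivity
  have hcD' : (c - 1) * D ≤ w / 16 := by linarith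
  -- A color with large excess in a convex region has all its points there of large degree.
  have hexc : ∀ K : Set Plane, Convex ℝ K → ∀ j : Fin c,
      c * ((P.filter fun x => x ∈ K ∧ φ x = j).card : ℝ) ≤ ((P.filter (· ∈ K)).card : ℝ) + D ∨
        (P.filter fun x => x ∈ K ∧ φ x = j) ⊆ V := by
    intro K hK j
    by_contra! hcon
    obtain ⟨hlt', hns⟩ := hcon
    obtain ⟨p, hp, hpV⟩ := Finset.not_subset.1 hns
    obtain ⟨hpP, hpK, rfl⟩ := Finset.mem_filter.1 hp
    have hdeg : (triangleDegree P φ s p : ℝ) < t := by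
      by_contra! h
      exact hpV (Finset.mem_filter.2 ⟨hpP, h⟩)
    have h1 : (c : ℝ) * ((P.filter fun x => x ∈ K ∧ φ x = φ p).card : ℝ) ≤
        ((P.filter (· ∈ K)).card : ℝ) + (s + 1) * (triangleDegree P φ s p + 2) := by
      exact_mod_cast mul_card_color_le hc hP φ hK hpP hpK
    have h2 : ((s : ℝ) + 1) * (triangleDegree P φ s p + 2) ≤ D :=
      mul_le_mul_of_nonneg_left (by linarith) (by positivity)
    linarith
  -- The points of small degree in a most frequent color.
  obtain ⟨j₀, hj₀⟩ : ∃ j₀ : Fin c, y ≤ ((P.filter (φ · = j₀)).card : ℝ) := by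
    by_contra! hcon
    have h1 := sum_card_color P φ Set.univ
    simp only [Set.mem_univ, true_and, Finset.filter_true] at h1
    have h2 : ∑ i : Fin c, ((P.filter (φ · = i)).card : ℝ) < ∑ _i : Fin c, y :=
      Finset.sum_lt_sum_of_nonempty ⟨⟨0, by omega⟩, Finset.mem_univ _⟩ fun i _ => hcon i
    rw [h1, Finset.sum_const, Finset.card_univ, Fintype.card_fin, nsmul_eq_mul] at h2
    linarith
  set U := (P.filter (φ · = j₀)) \ V with hU
  have hUm : ∀ x, x ∈ U → x ∈ P ∧ φ x = j₀ ∧ (triangleDegree P φ s x : ℝ) < t := by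
    intro x hx
    obtain ⟨hx1, hx2⟩ := Finset.mem_sdiff.1 hx
    obtain ⟨hxP, hxj⟩ := Finset.mem_filter.1 hx1
    refine ⟨hxP, hxj, ?_⟩
    by_contra! h
    exact hx2 (Finset.mem_filter.2 ⟨hxP, h⟩)
  have hUcard : y - V.card ≤ (U.card : ℝ) := by
    have := Finset.le_card_sdiff V (P.filter (φ · = j₀))
    have h1 : (P.filter (φ · = j₀)).card ≤ U.card + V.card := by rw [hU]; omega
    have h2 : ((P.filter (φ · = j₀)).card : ℝ) ≤ U.card + V.card := by exact_mod_cast h1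
    linarith
  obtain ⟨H, hHU, hHull, hHext⟩ := exists_hull_vertices U
  set K₀ := convexHull ℝ (U : Set Plane) with hK₀
  have hK₀c : Convex ℝ K₀ := convex_convexHull ℝ _
  have hUK : ∀ x ∈ U, x ∈ K₀ := fun x hx => subset_convexHull ℝ _ hx
  set q : ℝ := ((P.filter (· ∈ K₀)).card : ℝ) with hq
  have hr : (U.card : ℝ) ≤ ((P.filter fun x => x ∈ K₀ ∧ φ x = j₀).card : ℝ) := by
    refine Nat.cast_le.2 (Finset.card_le_card fun x hx => ?_)
    exact Finset.mem_filter.2 ⟨(hUm x hx).1, hUK x hx, (hUm x hx).2.1⟩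
  have hUq : (U.card : ℝ) ≤ q := by
    refine Nat.cast_le.2 (Finset.card_le_card fun x hx => ?_)
    exact Finset.mem_filter.2 ⟨(hUm x hx).1, hUK x hx⟩
  have hbal : ∀ j : Fin c,
      c * ((P.filter fun x => x ∈ K₀ ∧ φ x = j).card : ℝ) ≤ q + D := by
    intro j
    rcases hexc K₀ hK₀c j with h | h
    · exact h
    · have h1 : ((P.filter fun x => x ∈ K₀ ∧ φ x = j).card : ℝ) ≤ V.card :=
        Nat.cast_le.2 (Finset.card_le_card h)
      have h2 := mul_le_mul_of_nonneg_left h1 hc0.le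
      linarith
  have hlow := sub_le_mul_of_forall_mul_le (sum_card_color P φ K₀) hbal
  -- The hull has few vertices: another color has almost the same share in its own, smaller hull.
  have hHcard : (H.card : ℝ) ≤ c * D := by
    obtain ⟨j₁, hj₁⟩ : ∃ j₁ : Fin c, j₁ ≠ j₀ := by
      have : Nontrivial (Fin c) := Fin.nontrivial_iff_two_le.2 (by omega)
      exact exists_ne j₀
    set B := P.filter fun x => x ∈ K₀ ∧ φ x = j₁ with hB
    have hBm : ∀ x ∈ B, x ∈ P ∧ x ∈ K₀ ∧ φ x = j₁ := fun x hx => Finset.mem_filter.1 hx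
    set K₁ := convexHull ℝ (B : Set Plane) with hK₁
    have hBr : (B.card : ℝ) ≤ ((P.filter fun x => x ∈ K₁ ∧ φ x = j₁).card : ℝ) := by
      refine Nat.cast_le.2 (Finset.card_le_card fun x hx => ?_)
      exact Finset.mem_filter.2 ⟨(hBm x hx).1, subset_convexHull ℝ _ hx, (hBm x hx).2.2⟩
    have hBlow : q - (c - 1) * D ≤ c * B.card := hlow j₁
    have hBr' := mul_le_mul_of_nonneg_left hBr hc0.le
    have h1 : c * (B.card : ℝ) ≤ ((P.filter (· ∈ K₁)).card : ℝ) + D := by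
      rcases hexc K₁ (convex_convexHull ℝ _) j₁ with h | h
      · linarith
      · exfalso
        have h1 : ((P.filter fun x => x ∈ K₁ ∧ φ x = j₁).card : ℝ) ≤ V.card :=
          Nat.cast_le.2 (Finset.card_le_card h)
        have h2 := mul_le_mul_of_nonneg_left h1 hc0.le
        linarith
    have hHK₁ : ∀ x ∈ H, x ∉ K₁ := by
      intro x hx hxK
      refine (convexHull_min (t := K₀ \ {x}) (fun z hz => ⟨(hBm z hz).2.1, fun hzx => ?_⟩)
        (hHext x hx) hxK).2 rfl
      rw [Set.mem_singleton_iff.1 hzx] at hz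
      exact hj₁ ((hBm x hz).2.2.symm.trans (hUm x (hHU hx)).2.1)
    have h2 : (P.filter (· ∈ K₁)).card + H.card ≤ (P.filter (· ∈ K₀)).card := by
      rw [← Finset.card_union_of_disjoint]
      · refine Finset.card_le_card (Finset.union_subset (fun x hx => ?_) fun x hx => ?_)
        · obtain ⟨hxP, hxK⟩ := Finset.mem_filter.1 hx
          exact Finset.mem_filter.2 ⟨hxP,
            convexHull_min (fun z hz => (hBm z hz).2.1) hK₀c hxK⟩
        · exact Finset.mem_filter.2 ⟨(hUm x (hHU hx)).1, hUK x (hHU hx)⟩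
      · exact Finset.disjoint_left.2 fun x hx hxH => hHK₁ x hxH (Finset.mem_filter.1 hx).2
    have h3 : ((P.filter (· ∈ K₁)).card : ℝ) + H.card ≤ q := by
      rw [hq]; exact_mod_cast h2
    linarith
  have hHP : H ⊆ P := fun x hx => (hUm x (hHU hx)).1
  have hHne : H.Nonempty := by
    rw [Finset.nonempty_iff_ne_empty]
    rintro rfl
    have hU0 : (U : Set Plane) = ∅ := by
      rw [← convexHull_eq_empty (𝕜 := ℝ), ← hK₀, ← hHull]; simp
    have : U.card = 0 := by
      rw [Finset.card_eq_zero]; exact_mod_cast hU0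
    rw [this] at hUcard
    simp at hUcard
    linarith
  obtain ⟨a, ha, hstar, hcov⟩ := exists_triangulating_fan hP hHP hHne
    (fun x hx => by rw [hHull]; exact hHext x hx)
  set E := consecutive a (H.erase a) with hE
  have hEcard : (E.card : ℝ) ≤ c * D := by
    refine le_trans (Nat.cast_le.2 ?_) hHcard
    exact hstar.card_consecutive_le.trans (Finset.card_le_card (Finset.erase_subset _ _))
  -- Some triangle of the fan has many points of the color `j₀` beyond those of large degree.
  obtain ⟨e, he, hbig⟩ : ∃ e ∈ E, ((V.filter (· ∈ tri a e.1 e.2)).card : ℝ) + (3 * t + D) ^ 2 <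
      ((P.filter fun x => x ∈ tri a e.1 e.2 ∧ φ x = j₀).card : ℝ) := by
    by_contra! hcon
    have h1 := Finset.sum_le_sum hcon
    rw [Finset.sum_add_distrib, Finset.sum_const, nsmul_eq_mul] at h1
    have h2 : ∑ e ∈ E, ((V.filter (· ∈ tri a e.1 e.2)).card : ℝ) ≤ V.card := by
      have h3 : ∑ e ∈ E, (V.filter (· ∈ tri a e.1 e.2)).card ≤ V.card := by
        rw [← Finset.card_biUnion]
        · exact Finset.card_le_card (Finset.biUnion_subset.2 fun e _ => Finset.filter_subset _ _)
        · intro e he e' he' hne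
          exact Finset.disjoint_left.2 fun x hx hx' => Set.disjoint_left.1
            (hstar.disjoint_tri he he' hne) (Finset.mem_filter.1 hx).2 (Finset.mem_filter.1 hx').2
      exact_mod_cast h3
    have h4 : ((P.filter fun x => x ∈ K₀ ∧ φ x = j₀).card : ℝ) ≤
        ∑ e ∈ E, ((P.filter fun x => x ∈ tri a e.1 e.2 ∧ φ x = j₀).card : ℝ) + H.card := by
      have hsub : (P.filter fun x => x ∈ K₀ ∧ φ x = j₀) ⊆
          (E.biUnion fun e => P.filter fun x => x ∈ tri a e.1 e.2 ∧ φ x = j₀) ∪ H := by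
        intro x hx
        obtain ⟨hxP, hxK, hxj⟩ := Finset.mem_filter.1 hx
        rw [Finset.mem_union]
        by_cases hxH : x ∈ H
        · exact Or.inr hxH
        · obtain ⟨e, he, hxe⟩ := hcov x hxP (by rw [hHull]; exact hxK) hxH
          exact Or.inl (Finset.mem_biUnion.2 ⟨e, he, Finset.mem_filter.2 ⟨hxP, hxe, hxj⟩⟩)
      have h5 := (Finset.card_le_card hsub).trans ((Finset.card_union_le _ _).trans
        (Nat.add_le_add_right Finset.card_biUnion_le _))
      exact_mod_cast h5
    have h6 : (E.card : ℝ) * (3 * t + D) ^ 2 ≤ c * D * (3 * t + D) ^ 2 :=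
      mul_le_mul_of_nonneg_right hEcard (sq_nonneg _)
    linarith
  obtain ⟨⟨he1, he2⟩, hpos, -⟩ := mem_consecutive.1 he
  -- The other colors do not dominate in this triangle.
  have hTlow : ((P.filter (· ∈ tri a e.1 e.2)).card : ℝ) - (c - 1) * D ≤
      c * ((P.filter fun x => x ∈ tri a e.1 e.2 ∧ φ x = j₀).card : ℝ) := by
    by_cases hall : ∀ j : Fin c,
        c * ((P.filter fun x => x ∈ tri a e.1 e.2 ∧ φ x = j).card : ℝ) ≤
          ((P.filter (· ∈ tri a e.1 e.2)).card : ℝ) + D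
    · exact sub_le_mul_of_forall_mul_le (sum_card_color P φ _) hall j₀
    · push Not at hall
      obtain ⟨j, hj⟩ := hall
      have hjV := (hexc _ (convex_tri _ _ _) j).resolve_left (not_le.2 hj)
      have h1 : ((P.filter fun x => x ∈ tri a e.1 e.2 ∧ φ x = j).card : ℝ) ≤
          ((V.filter (· ∈ tri a e.1 e.2)).card : ℝ) :=
        Nat.cast_le.2 (Finset.card_le_card fun x hx => Finset.mem_filter.2
          ⟨hjV hx, (Finset.mem_filter.1 hx).2.1⟩)
      have h2 : ((P.filter fun x => x ∈ tri a e.1 e.2 ∧ φ x = j).card : ℝ) ≤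
          ((P.filter fun x => x ∈ tri a e.1 e.2 ∧ φ x = j₀).card : ℝ) := by
        linarith [sq_nonneg (3 * t + D)]
      have h3 := mul_le_mul_of_nonneg_left h2 hc0.le
      have h4 : 0 ≤ (c - 1) * D := mul_nonneg (by linarith) hD0.le
      linarith
  -- The corners have small degree, which bounds the number of points inside.
  obtain ⟨ha1, ha2, ha3⟩ := hUm a (hHU ha)
  obtain ⟨hx1, hx2, hx3⟩ := hUm _ (hHU (Finset.mem_of_mem_erase he1))
  obtain ⟨hz1, hz2, hz3⟩ := hUm _ (hHU (Finset.mem_of_mem_erase he2))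
  obtain ⟨m, hm, hmdeg⟩ := exists_corner_degree_bound (s := s) hP φ ha1 hx1 hz1 ha2 hx2 hz2 hpos
  set k := (P.filter fun x => x ∈ tri a e.1 e.2 ∧ φ x = j₀).card with hk
  have hmdeg' : ((s : ℝ) + 1) * (k + m + 1) + k ≤
      (s + 1) * (triangleDegree P φ s a + triangleDegree P φ s e.1 + triangleDegree P φ s e.2) +
        ((P.filter (· ∈ tri a e.1 e.2)).card : ℝ) := by exact_mod_cast hmdeg
  have hm' : (k : ℝ) ≤ (m : ℝ) ^ 2 := by exact_mod_cast hm
  have hs0 : (0 : ℝ) < s + 1 := by positivity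
  have hdeg3 : ((s : ℝ) + 1) * (triangleDegree P φ s a + triangleDegree P φ s e.1 +
      triangleDegree P φ s e.2) ≤ (s + 1) * (3 * t) :=
    mul_le_mul_of_nonneg_left (by linarith) hs0.le
  have hmD : (m : ℝ) ≤ 3 * t + D := by
    refine le_of_mul_le_mul_left (a := (s : ℝ) + 1) ?_ hs0
    have hcs : (c : ℝ) = s + 1 + 1 := by linarith
    rw [← hsc] at hTlow
    rw [hcs] at hTlow
    linarith
  have hmm : (m : ℝ) ^ 2 ≤ (3 * t + D) ^ 2 := pow_le_pow_left₀ (Nat.cast_nonneg _) hmD 2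
  have : (0 : ℝ) ≤ (V.filter (· ∈ tri a e.1 e.2)).card := Nat.cast_nonneg _
  linarith

theorem mul_rpow_le_card_monoTriangles {c s : ℕ} (hc : c = s + 2) {P : Finset Plane}
    (hP : GeneralPosition P) (φ : Plane → Fin c) (hn : 512 * c ^ 6 ≤ P.card) :
    1 / (96 * (c : ℝ) ^ 4) * (P.card : ℝ) ^ (4 / 3 : ℝ) ≤ (monoTriangles P φ s).card := by
  classical
  have hc0 : (0 : ℝ) < c := by rw [hc]; positivity
  have hn0 : (0 : ℝ) ≤ P.card := Nat.cast_nonneg _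
  set r : ℝ := (P.card : ℝ) ^ (1 / 3 : ℝ) with hr
  have hr0 : 0 ≤ r := Real.rpow_nonneg hn0 _
  have hr3 : r ^ 3 = P.card := by
    rw [hr, ← Real.rpow_natCast, ← Real.rpow_mul hn0]
    norm_num
  have hr4 : (P.card : ℝ) ^ (4 / 3 : ℝ) = P.card * r := by
    rw [hr, show (4 / 3 : ℝ) = 1 + 1 / 3 by norm_num, Real.rpow_add' hn0 (by norm_num),
      Real.rpow_one]
  have hrc : 8 * (c : ℝ) ^ 2 ≤ r := by
    have hn' : (512 : ℝ) * c ^ 6 ≤ P.card := by exact_mod_cast hn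
    refine le_of_pow_le_pow_left₀ (n := 3) (by norm_num) hr0 ?_
    rw [hr3]
    refine le_trans (le_of_eq ?_) hn'
    ring
  set t : ℝ := r / (4 * (c : ℝ) ^ 2) with ht
  have hrt : r = 4 * (c : ℝ) ^ 2 * t := by rw [ht]; field_simp
  have ht2 : 2 ≤ t := by
    rw [ht, le_div_iff₀ (by positivity)]
    linarith
  have hheavy := card_le_mul_card_heavy hc hP φ (s := s) ht2 (by
    rw [← hr3, hrt]
    exact le_of_eq (by ring))
  set V := P.filter fun p => t ≤ (triangleDegree P φ s p : ℝ) with hV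
  have hsum : (V.card : ℝ) * t ≤ 3 * (monoTriangles P φ s).card := by
    calc (V.card : ℝ) * t = V.card • t := by rw [nsmul_eq_mul]
      _ ≤ ∑ p ∈ V, (triangleDegree P φ s p : ℝ) :=
          Finset.card_nsmul_le_sum _ _ _ fun p hp => (Finset.mem_filter.1 hp).2
      _ ≤ ∑ p ∈ P, (triangleDegree P φ s p : ℝ) :=
          Finset.sum_le_sum_of_subset_of_nonneg (Finset.filter_subset _ _)
            fun _ _ _ => Nat.cast_nonneg _
      _ ≤ 3 * (monoTriangles P φ s).card := by exact_mod_cast sum_triangleDegree_le P φ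
  rw [hr4, div_mul_eq_mul_div, one_mul, div_le_iff₀ (by positivity)]
  calc (P.card : ℝ) * r ≤ 8 * (c : ℝ) ^ 2 * V.card * r := mul_le_mul_of_nonneg_right hheavy hr0
    _ = 32 * (c : ℝ) ^ 4 * (V.card * t) := by rw [hrt]; ring
    _ ≤ 32 * (c : ℝ) ^ 4 * (3 * (monoTriangles P φ s).card) :=
        mul_le_mul_of_nonneg_left hsum (by positivity)
    _ = (monoTriangles P φ s).card * (96 * (c : ℝ) ^ 4) := by ring

end AlmostEmpty

theorem theorem2 (c : ℕ) (hc : 2 ≤ c) :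
    ∃ L : ℝ, 0 < L ∧ ∃ N : ℕ, ∀ n : ℕ, N ≤ n →
      L * (n : ℝ) ^ (4 / 3 : ℝ) ≤ (AlmostEmpty.minMonoTrianglesOfCard c (c - 2) n : ℝ) := by
  refine ⟨1 / (96 * (c : ℝ) ^ 4), by positivity, 512 * c ^ 6, fun n hn => ?_⟩
  -- Both infima are over non-empty sets of natural numbers, hence attained.
  obtain ⟨P₀, hP₀, hP₀n⟩ := AlmostEmpty.exists_generalPosition n
  obtain ⟨P, hP, rfl, hmin⟩ := Nat.sInf_mem
    (s := {m : ℕ | ∃ P : Finset AlmostEmpty.Plane, AlmostEmpty.GeneralPosition P ∧ P.card = n ∧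
      m = AlmostEmpty.minMonoTriangles c (c - 2) P}) ⟨_, P₀, hP₀, hP₀n, rfl⟩
  obtain ⟨φ, hφ⟩ := Nat.sInf_mem
    (s := {m : ℕ | ∃ φ : AlmostEmpty.Plane → Fin c,
      m = (AlmostEmpty.monoTriangles P φ (c - 2)).card}) ⟨_, fun _ => ⟨0, by omega⟩, rfl⟩
  rw [AlmostEmpty.minMonoTrianglesOfCard, hmin, AlmostEmpty.minMonoTriangles, hφ]
  exact AlmostEmpty.mul_rpow_le_card_monoTriangles (by omega) hP φ hn
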